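/- Let $n,m\ge 0$ and let $\mathcal A=\{H_1,\dots,H_m\}$ be a multiarrangement of linear hyperplanes in $\mathbb C^n$ with normal vectors $\alpha_1,\dots,\alpha_m\in\mathbb C^n$, so that $H_i=\{z\in\mathbb C^n:\sum_k(\alpha_i)_kz_k=0\}$; repetitions are allowed, and so are degenerate hyperplanes $H_i=\mathbb C^n$ (that is, $\alpha_i=0$). For $S\subseteq\{1,\dots,m\}$ let $\mathrm{rk}(S)$ be the dimension of the span of $\{\alpha_i:i\in S\}$, let $r=\mathrm{rk}(\{1,\dots,m\})$ be the rank of $\mathcal A$, and let $$T_{\mathcal A}(x,y)=\sum_{S\subseteq\{1,\dots,m\}}(x-1)^{r-\mathrm{rk}(S)}(y-1)^{|S|-\mathrm{rk}(S)}$$ be its Tutte polynomial. Let $\Omega_n=\mathbb C[x_1,\dots,x_n]\otimes\wedge\{\theta_1,\dots,\theta_n\}$, bigraded by $\deg x_i=(1,0)$ (bosonic degree) and $\deg\theta_i=(0,1)$ (fermionic degree), and let $d:\Omega_n\to\Omega_n$ be $df=\sum_{i=1}^n(\partial f/\partial x_i)\cdot\theta_i$. For a line $L=\mathbb C\cdot(\ell_1,\dots,\ell_n)\subseteq\mathbb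 C^n$ put $\lambda_L=\ell_1x_1+\cdots+\ell_nx_n$ and $\rho_{\mathcal A}(L)=\#\{1\le i\le m: L\not\subseteq H_i\}$. Let $J_{\mathcal A,1}\subseteq\mathbb C[x_1,\dots,x_n]$ be the ideal generated by all $\lambda_L^{\rho_{\mathcal A}(L)+1}$, $L\subseteq\mathbb C^n$ a line, and let $I_{\mathcal A}\subseteq\Omega_n$ be its differential closure, the smallest two-sided ideal of $\Omega_n$ that contains $J_{\mathcal A,1}$ and is closed under $d$. Put $\mathcal E_{\mathcal A}=\Omega_n/I_{\mathcal A}$ and $$I_{\mathcal A}^{\perp}=\{g\in\Omega_n: f\odot g=0\text{ for all }f\in I_{\mathcal A}\},\qquad f\odot g=f(\partial_1,\dots,\partial_n,\partial^\theta_1,\dots,\partial^\theta_n)(g),$$ where $\partial_i=\partial/\partial x_i$ and $\partial^\theta_i$ is the contraction operator, $\partial_i^\theta(\theta_{j_1}\cdots\theta_{j_k})=(-1)^{s-1}\theta_{j_1}\cdots\widehat{\theta_{j_s}}\cdots\theta_{j_k}$ if $j_s=i$ and $0$ if $i\notin\{j_1,\dots,j_k\}$ (for distinct $j_1,\dots,j_k$).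 Then $\mathcal E_{\mathcal A}$ and $I_{\mathcal A}^\perp$ inherit bigradings from $\Omega_n$ (each is the direct sum of its bihomogeneous pieces), and their bigraded Hilbert series $\mathrm{Hilb}(V;q,t)=\sum_{i,j\ge0}\dim_{\mathbb C}(V_{i,j})\,q^it^j$, where $q$ tracks bosonic degree and $t$ tracks fermionic degree, satisfy $$\mathrm{Hilb}(\mathcal E_{\mathcal A};q,t)=\mathrm{Hilb}(I_{\mathcal A}^{\perp};q,t)=(1+t)^r\,q^{m-r}\,T_{\mathcal A}\!\left(\frac{1+q+t}{1+t},\frac1q\right),$$ an identity in the field of fractions of $\mathbb Z[[q,t]]$. -/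

import Mathlib

open scoped TensorProduct

noncomputable section

/-! ### Superspace -/

/-- The polynomial ring `ℂ[x₁, …, xₙ]` in the bosonic variables. -/
abbrev BosonicRing (n : ℕ) : Type := MvPolynomial (Fin n) ℂ

/-- The exterior algebra `∧{θ₁, …, θₙ}` in the fermionic variables. -/
abbrev FermionicRing (n : ℕ) : Type := ExteriorAlgebra ℂ (Fin n → ℂ)

/-- Rank `n` superspace `Ωₙ = ℂ[x₁, …, xₙ] ⊗ ∧{θ₁, …, θₙ}`. -/
abbrev Superspace (n : ℕ) : Type := BosonicRing n ⊗[ℂ] FermionicRing n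

namespace Superspace

/-- The fermionic variable `θᵢ` as an element of the exterior algebra. -/
def theta {n : ℕ} (i : Fin n) : FermionicRing n :=
  ExteriorAlgebra.ι ℂ (Pi.single i (1 : ℂ) : Fin n → ℂ)

/-- `(Ωₙ)_{i,j} = ℂ[x]ᵢ ⊗ ∧ʲ{θ}`: bosonic degree `p.1 = i`, fermionic degree `p.2 = j`. -/
def bidegree (n : ℕ) (p : ℕ × ℕ) : Submodule ℂ (Superspace n) :=
  Submodule.map₂ (TensorProduct.mk ℂ (BosonicRing n) (FermionicRing n))
    (MvPolynomial.homogeneousSubmodule (Fin n) ℂ p.1)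
    (⋀[ℂ]^(p.2) (Fin n → ℂ))

/-- Each bihomogeneous piece of superspace is finite-dimensional. -/
instance finite_bidegree (n : ℕ) (p : ℕ × ℕ) : Module.Finite ℂ (bidegree n p) := by
  have h1 := MvPolynomial.homogeneousSubmodule_fg (σ := Fin n) (R := ℂ) p.1
  have h2 : (⋀[ℂ]^(p.2) (Fin n → ℂ)).FG := Module.Finite.iff_fg.mp inferInstance
  exact Module.Finite.iff_fg.mpr (Submodule.FG.map₂ _ h1 h2)

/-- The Euler operator (total derivative) `d f = ∑ᵢ (∂f/∂xᵢ) · θᵢ`, where the `θ`-variables are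
treated as constants in `∂f/∂xᵢ`. -/
def euler (n : ℕ) : Superspace n →ₗ[ℂ] Superspace n :=
  ∑ i : Fin n, TensorProduct.map
    (MvPolynomial.pderiv (R := ℂ) i).toLinearMap (LinearMap.mulRight ℂ (theta i))

/-- An ideal of `Ωₙ` is a (two-sided) differential ideal when it is closed under `d`. -/
def IsDifferentialIdeal {n : ℕ} (K : Ideal (Superspace n)) : Prop :=
  K.IsTwoSided ∧ ∀ f ∈ K, euler n f ∈ K

/-- The differential closure `J^θ` of an ideal `J ⊆ ℂ[x]`: the intersection of all differential
ideals of `Ωₙ` that contain `J`. -/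
def differentialClosure {n : ℕ} (J : Ideal (BosonicRing n)) : Ideal (Superspace n) :=
  sInf {K | IsDifferentialIdeal K ∧ ∀ g ∈ J, g ⊗ₜ[ℂ] (1 : FermionicRing n) ∈ K}

/-- The differential closure is the smallest differential ideal containing `J`. -/
theorem isLeast_differentialClosure {n : ℕ} (J : Ideal (BosonicRing n)) :
    IsLeast {K | IsDifferentialIdeal K ∧ ∀ g ∈ J, g ⊗ₜ[ℂ] (1 : FermionicRing n) ∈ K}
      (differentialClosure J) := by
  refine ⟨⟨⟨⟨?_⟩, ?_⟩, ?_⟩, fun K hK => sInf_le hK⟩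
  · intro a b ha
    rw [differentialClosure, Submodule.mem_sInf] at ha ⊢
    intro K hK
    have := hK.1.1
    exact Ideal.mul_mem_right _ K (ha K hK)
  · intro f hf
    rw [differentialClosure, Submodule.mem_sInf] at hf ⊢
    exact fun K hK => hK.1.2 f (hf K hK)
  · intro g hg
    rw [differentialClosure, Submodule.mem_sInf]
    exact fun K hK => hK.2 g hg

instance isTwoSided_differentialClosure {n : ℕ} (J : Ideal (BosonicRing n)) :
    (differentialClosure J).IsTwoSided :=
  (isLeast_differentialClosure J).1.1.1

/-! ### The action of superspace on itself and inverse systems -/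

/-- The linear map `f ↦ f(∂₁, …, ∂ₙ)` from polynomials to operators on polynomials; on the
monomial `x^a` it is `∂₁^{a₁} ∘ ⋯ ∘ ∂ₙ^{aₙ}`. -/
def bosonicOp (n : ℕ) : BosonicRing n →ₗ[ℂ] Module.End ℂ (BosonicRing n) :=
  (MvPolynomial.basisMonomials (Fin n) ℂ).constr ℂ fun a =>
    (List.ofFn fun i : Fin n =>
      ((MvPolynomial.pderiv (R := ℂ) i).toLinearMap : Module.End ℂ (BosonicRing n)) ^ a i).prod

/-- The algebra map `f ↦ f(∂₁^θ, …, ∂ₙ^θ)` from the exterior algebra to operators on it. The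
generator `∑ vᵢ θᵢ` acts by contraction against the functional `θᵢ ↦ vᵢ`; in particular `θᵢ` acts
by the contraction operator `∂ᵢ^θ`. -/
def fermionicOp (n : ℕ) : FermionicRing n →ₐ[ℂ] Module.End ℂ (FermionicRing n) :=
  ExteriorAlgebra.lift ℂ
    ⟨CliffordAlgebra.contractLeft (Q := (0 : QuadraticForm ℂ (Fin n → ℂ))) ∘ₗ
        (dotProductEquiv ℂ (Fin n)).toLinearMap,
      fun _ => LinearMap.ext fun w => CliffordAlgebra.contractLeft_contractLeft _ w⟩

/-- The linear map `f ↦ ∂f = f(∂₁, …, ∂ₙ, ∂₁^θ, …, ∂ₙ^θ)`, so that `f ⊙ g = superOp n f g`. -/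
def superOp (n : ℕ) : Superspace n →ₗ[ℂ] Module.End ℂ (Superspace n) :=
  TensorProduct.homTensorHomMap (RingHom.id ℂ)
      (BosonicRing n) (FermionicRing n) (BosonicRing n) (FermionicRing n) ∘ₗ
    TensorProduct.map (bosonicOp n) (fermionicOp n).toLinearMap

/-- The Macaulay inverse system `I^⊥ = {g | f ⊙ g = 0 for all f ∈ I}`. -/
def inverseSystem {n : ℕ} (I : Ideal (Superspace n)) : Submodule ℂ (Superspace n) where
  carrier := {g | ∀ f ∈ I, superOp n f g = 0}
  zero_mem' := fun f _ => map_zero _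
  add_mem' := fun {a b} ha hb f hf => by rw [map_add, ha f hf, hb f hf, add_zero]
  smul_mem' := fun c g hg f hf => by rw [map_smul, hg f hf, smul_zero]

/-! ### Bigraded Hilbert series -/

/-- The bidegree pieces of the quotient `Ωₙ / I`: images of the bidegree pieces of `Ωₙ`. -/
def quotientPiece {n : ℕ} (I : Ideal (Superspace n)) [I.IsTwoSided] (p : ℕ × ℕ) :
    Submodule ℂ (Superspace n ⧸ I) :=
  (bidegree n p).map (Ideal.Quotient.mkₐ ℂ I).toLinearMap

/-- The bidegree pieces of a subspace `V ⊆ Ωₙ`, that is `V ∩ (Ωₙ)_{i,j}`, as subspaces of `V`. -/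
def subspacePiece {n : ℕ} (V : Submodule ℂ (Superspace n)) (p : ℕ × ℕ) : Submodule ℂ V :=
  (bidegree n p).comap V.subtype

instance finite_quotientPiece {n : ℕ} (I : Ideal (Superspace n)) [I.IsTwoSided] (p : ℕ × ℕ) :
    Module.Finite ℂ (quotientPiece I p) := by
  unfold quotientPiece
  infer_instance

instance finite_subspacePiece {n : ℕ} (V : Submodule ℂ (Superspace n)) (p : ℕ × ℕ) :
    Module.Finite ℂ (subspacePiece V p) := by
  have : IsNoetherian ℂ (bidegree n p) := isNoetherian_of_isNoetherianRing_of_finite ℂ (bidegree n p)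
  refine Module.Finite.of_injective
    (LinearMap.restrict (p := subspacePiece V p) (q := bidegree n p) V.subtype fun _ hx => hx) ?_
  intro x y h
  have h2 : ((x : V) : Superspace n) = y := congrArg (fun z : bidegree n p => (z : Superspace n)) h
  exact Subtype.ext (Subtype.ext h2)

end Superspace

/-- The bigraded Hilbert series `∑ dim(V_{i,j}) q^i t^j` of a family of subspaces, as a formal power
series in the variables `q = X 0` and `t = X 1`. -/
def bigradedHilbertSeries {M : Type*} [AddCommMonoid M] [Module ℂ M]
    (V : ℕ × ℕ → Submodule ℂ M) : MvPowerSeries (Fin 2) ℤ :=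
  fun a => (Module.finrank ℂ (V (a 0, a 1)) : ℤ)

instance isDomain_twoVariableSeries : IsDomain (MvPowerSeries (Fin 2) ℤ) :=
  NoZeroDivisors.to_isDomain _

/-- The field of fractions of `ℤ⟦q, t⟧`. -/
abbrev SeriesField : Type := FractionRing (MvPowerSeries (Fin 2) ℤ)

/-- The variable `q` (bosonic degree). -/
def qVar : SeriesField := algebraMap (MvPowerSeries (Fin 2) ℤ) SeriesField (MvPowerSeries.X 0)

/-- The variable `t` (fermionic degree). -/
def tVar : SeriesField := algebraMap (MvPowerSeries (Fin 2) ℤ) SeriesField (MvPowerSeries.X 1)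

/-! ### Multiarrangements -/

/-- A multiarrangement of `m` linear hyperplanes in `ℂⁿ`, indexed by `ι` with `#ι = m` and given by
its normal vectors (each of them unique up to a nonzero scalar). A zero normal vector is allowed and
gives a degenerate hyperplane, that is a loop. -/
abbrev Multiarrangement (ι : Type*) (n : ℕ) := ι → Fin n → ℂ

namespace Multiarrangement

variable {ι : Type*} {n : ℕ}

/-- The hyperplane `Hᵢ = {z | ∑ₖ (αᵢ)ₖ zₖ = 0}`. -/
def hyperplane (A : Multiarrangement ι n) (i : ι) : Submodule ℂ (Fin n → ℂ) :=
  LinearMap.ker (dotProductEquiv ℂ (Fin n) (A i))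

/-- The rank of a subset of the hyperplanes: the dimension of the span of its normal vectors. This
is the rank function of the matroid of the arrangement. -/
def rk (A : Multiarrangement ι n) (S : Finset ι) : ℕ :=
  Module.finrank ℂ (Submodule.span ℂ (A '' (S : Set ι)))

/-- The rank of the arrangement. -/
def rank [Fintype ι] (A : Multiarrangement ι n) : ℕ := A.rk Finset.univ

/-- The Tutte polynomial `T(x, y) = ∑_S (x - 1)^{r - rk S} (y - 1)^{#S - rk S}` of the matroid of the
arrangement, with `x = X 0` and `y = X 1`. Both exponents are differences `a - b` with `b ≤ a`. -/
def tutte [Fintype ι] (A : Multiarrangement ι n) : MvPolynomial (Fin 2) ℤ :=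
  ∑ S : Finset ι, (MvPolynomial.X 0 - 1) ^ (A.rank - A.rk S) *
    (MvPolynomial.X 1 - 1) ^ (S.card - A.rk S)

open Classical in
/-- For the line `L = ℂ · ℓ`, the number `ρ(L)` of hyperplanes (with multiplicity) that do not
contain `L`. -/
def rho [Fintype ι] (A : Multiarrangement ι n) (l : Fin n → ℂ) : ℕ :=
  (Finset.univ.filter fun i => ¬ Submodule.span ℂ {l} ≤ A.hyperplane i).card

/-- The linear form `λ_L = ℓ₁ x₁ + ⋯ + ℓₙ xₙ` of the line `L = ℂ · ℓ`. -/
def lineForm (l : Fin n → ℂ) : BosonicRing n := ∑ k, MvPolynomial.C (l k) * MvPolynomial.X k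

/-- The power ideal `J_{A,k} = (λ_L^{ρ(L) + k} : L ⊆ ℂⁿ a line)`, for `k ≥ 0`; a line is given by a
nonzero vector on it. -/
def powerIdeal [Fintype ι] (A : Multiarrangement ι n) (k : ℕ) : Ideal (BosonicRing n) :=
  Ideal.span {f | ∃ l : Fin n → ℂ, l ≠ 0 ∧ f = lineForm l ^ (A.rho l + k)}

/-- The superpower ideal `I_A ⊆ Ωₙ`: the differential closure of `J_{A,1}`. -/
def superIdeal [Fintype ι] (A : Multiarrangement ι n) : Ideal (Superspace n) :=
  Superspace.differentialClosure (A.powerIdeal 1)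

instance isTwoSided_superIdeal [Fintype ι] (A : Multiarrangement ι n) : A.superIdeal.IsTwoSided :=
  Superspace.isTwoSided_differentialClosure _

/-- The superspace external zonotopal algebra `E_A = Ωₙ / I_A`. -/
abbrev external [Fintype ι] (A : Multiarrangement ι n) : Type := Superspace n ⧸ A.superIdeal

/-- The bidegree pieces of `E_A`. -/
def externalPiece [Fintype ι] (A : Multiarrangement ι n) (p : ℕ × ℕ) : Submodule ℂ A.external :=
  Superspace.quotientPiece A.superIdeal p

/-- The bidegree pieces of `I_A^⊥`. -/
def inversePiece [Fintype ι] (A : Multiarrangement ι n) (p : ℕ × ℕ) :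
    Submodule ℂ (Superspace.inverseSystem A.superIdeal) :=
  Superspace.subspacePiece (Superspace.inverseSystem A.superIdeal) p

end Multiarrangement

end

namespace Superspace

open MvPolynomial Multiarrangement

variable {n : ℕ}

/-! ### The action of superspace on itself is multiplicative -/

/-! Expanding the Tutte polynomial turns the right-hand side into the sum over `X` of `q^(m - |X|)
(1 - q)^(|X| - rk X) (1 + t)^(rk X)` (`rankSum_eq_tutte`). In this normalization deletion and
contraction need no special case for coloops: a loop changes nothing, and for any other element the
sum is `q` times that of the deletion plus `1 + t` times that of the contraction. It remains to find
the same recursion for bigraded dimensions.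

The superpower ideal is generated, already as a left ideal, by the elements `λ^(ρ+1)` and `λ^ρ dλ`
(`superIdeal_eq_span`). Hence its inverse system is the solution space of `∂_l^(ρ(l)+1) g = 0` and
`∂_l^ρ(l) ∂_l^θ g = 0` (`inverseSystem_superIdeal`), and a pairing that is perfect in each bidegree
gives the quotient the same dimensions (`finrank_externalPiece`).

Contraction is modelled without changing the ambient space: everything is taken modulo `vanishing
W`, the ideal of the bosonic and fermionic forms in `W`, and only directions `l` orthogonal to `W`
are used. For `a ∉ W`, filter by `vanishing W ⊆ vanishing W + x_a Ω ⊆ vanishing (W + ℂa)`, where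
`x_a` and `θ_a` are the bosonic and fermionic forms of `a`. A solution for `a :: L` is modulo the
largest term a solution for the contraction; inside the largest term it is `θ_a` times such a
solution, modulo the middle term; inside the middle term it is `x_a` times a solution for the
deletion, modulo the smallest. These three layers account for `1`, `t` and `q`.

This bounds the solutions from above (`dimModulo_powerSolutions_cons_le`). The same filtration
bounds from below the span of the products of distinct `x_a` and `θ_a`
(`le_dimModulo_productSpan_cons`). Those products are solutions (`productSpan_le_powerSolutions`),
so at `W = ⊥` both bounds are equalities. The algebraic input is that `x_a` is regular modulo
`vanishing W` (`mem_vanishing_of_mulX`) and that modulo `x_a` the annihilator of `θ_a` is generated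
by `θ_a` (`mem_vanishing_of_mulTheta`). -/

theorem pderiv_commute (i j : Fin n) :
    ((pderiv (R := ℂ) i).toLinearMap : Module.End ℂ (BosonicRing n)) *
        (pderiv (R := ℂ) j).toLinearMap =
      (pderiv (R := ℂ) j).toLinearMap * (pderiv (R := ℂ) i).toLinearMap := by
  have h : ⁅(pderiv (R := ℂ) i : Derivation ℂ (BosonicRing n) (BosonicRing n)),
      pderiv (R := ℂ) j⁆ = 0 := by
    refine derivation_ext fun k => ?_
    rw [Derivation.commutator_apply, pderiv_X, pderiv_X, Pi.single_apply, Pi.single_apply]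
    split_ifs <;> simp
  refine LinearMap.ext fun f => ?_
  have hf := congrArg (fun D => D f) h
  simp only [Derivation.commutator_apply, Derivation.coe_zero, Pi.zero_apply] at hf
  exact sub_eq_zero.mp hf

/-- The operator attached to a polynomial depends multiplicatively on it. -/
theorem exists_algHom_eq_bosonicOp (n : ℕ) :
    ∃ ψ : BosonicRing n →ₐ[ℂ] Module.End ℂ (BosonicRing n),
      bosonicOp n = ψ.toLinearMap ∧ ∀ i, ψ (X i) = (pderiv (R := ℂ) i).toLinearMap := by
  let D : Fin n → Module.End ℂ (BosonicRing n) := fun i => (pderiv (R := ℂ) i).toLinearMap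
  have hcomm : ∀ a ∈ Set.range D, ∀ b ∈ Set.range D, a * b = b * a := by
    rintro _ ⟨i, rfl⟩ _ ⟨j, rfl⟩
    exact pderiv_commute i j
  -- Polynomial evaluation needs a commutative target, so the partial derivatives are evaluated in
  -- the subalgebra that they generate.
  have hS := Algebra.isMulCommutative_adjoin ℂ hcomm
  let : CommRing (Algebra.adjoin ℂ (Set.range D)) :=
    { (inferInstance : Ring (Algebra.adjoin ℂ (Set.range D))) with mul_comm := hS.is_comm.comm }
  let E : Fin n → Algebra.adjoin ℂ (Set.range D) :=
    fun i => ⟨D i, Algebra.subset_adjoin ⟨i, rfl⟩⟩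
  let φ : BosonicRing n →ₐ[ℂ] Algebra.adjoin ℂ (Set.range D) := aeval E
  refine ⟨(Algebra.adjoin ℂ (Set.range D)).val.comp φ, ?_, fun i => ?_⟩
  · refine (basisMonomials (Fin n) ℂ).ext fun a => ?_
    rw [bosonicOp, Module.Basis.constr_basis, coe_basisMonomials]
    have h1 : φ (monomial a 1) = (List.ofFn fun i => E i ^ a i).prod := by
      rw [List.prod_ofFn, aeval_monomial, map_one, one_mul, Finsupp.prod_fintype _ _ (by simp)]
    change _ = (Algebra.adjoin ℂ (Set.range D)).val (φ (monomial a 1))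
    rw [h1, map_list_prod, List.map_ofFn]
    rfl
  · change (Algebra.adjoin ℂ (Set.range D)).val (φ (X i)) = _
    rw [aeval_X]
    rfl

theorem bosonicOp_mul (f g : BosonicRing n) :
    bosonicOp n (f * g) = bosonicOp n f * bosonicOp n g := by
  obtain ⟨ψ, h, -⟩ := exists_algHom_eq_bosonicOp n
  simp only [h, AlgHom.toLinearMap_apply, map_mul]

theorem bosonicOp_X (i : Fin n) : bosonicOp n (X i) = (pderiv (R := ℂ) i).toLinearMap := by
  obtain ⟨ψ, h, hX⟩ := exists_algHom_eq_bosonicOp n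
  rw [h, AlgHom.toLinearMap_apply, hX]

theorem bosonicOp_one : bosonicOp n 1 = 1 := by
  obtain ⟨ψ, h, -⟩ := exists_algHom_eq_bosonicOp n
  rw [h, AlgHom.toLinearMap_apply, map_one]

theorem superOp_tmul (f : BosonicRing n) (a : FermionicRing n) :
    superOp n (f ⊗ₜ a) = TensorProduct.map (bosonicOp n f) (fermionicOp n a) := rfl

theorem superOp_mul (f g : Superspace n) : superOp n (f * g) = superOp n f * superOp n g := by
  induction f using TensorProduct.induction_on with
  | zero => simp
  | add f f' hf hf' => rw [add_mul, map_add, map_add, hf, hf', add_mul]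
  | tmul f a =>
    induction g using TensorProduct.induction_on with
    | zero => simp
    | add g g' hg hg' => rw [mul_add, map_add, map_add, hg, hg', mul_add]
    | tmul g b =>
      rw [Algebra.TensorProduct.tmul_mul_tmul, superOp_tmul, superOp_tmul, superOp_tmul,
        bosonicOp_mul, map_mul, Module.End.mul_eq_comp, Module.End.mul_eq_comp,
        Module.End.mul_eq_comp, TensorProduct.map_comp]

theorem superOp_one : superOp n 1 = 1 := by
  rw [Algebra.TensorProduct.one_def, superOp_tmul, bosonicOp_one, map_one]
  exact TensorProduct.map_one

theorem superOp_pow (f : Superspace n) (k : ℕ) : superOp n (f ^ k) = superOp n f ^ k := by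
  induction k with
  | zero => rw [pow_zero, pow_zero, superOp_one]
  | succ k ih => rw [pow_succ, pow_succ, superOp_mul, ih]

/-! ### Multiplication and differentiation operators -/

/-- The linear form `∑ aᵢ xᵢ` as an element of superspace. -/
noncomputable def bosonicForm : (Fin n → ℂ) →ₗ[ℂ] Superspace n where
  toFun a := lineForm a ⊗ₜ 1
  map_add' a b := by
    rw [← TensorProduct.add_tmul]
    simp [lineForm, add_mul, Finset.sum_add_distrib]
  map_smul' c a := by
    rw [RingHom.id_apply, TensorProduct.smul_tmul']
    simp [lineForm, Finset.smul_sum, MvPolynomial.smul_eq_C_mul, mul_assoc]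

/-- The linear form `∑ aᵢ θᵢ` as an element of superspace. -/
noncomputable def fermionicForm : (Fin n → ℂ) →ₗ[ℂ] Superspace n :=
  TensorProduct.mk ℂ (BosonicRing n) (FermionicRing n) 1 ∘ₗ ExteriorAlgebra.ι ℂ

/-- Multiplication by `∑ aᵢ xᵢ`. -/
noncomputable def mulX : (Fin n → ℂ) →ₗ[ℂ] Module.End ℂ (Superspace n) :=
  LinearMap.mul ℂ (Superspace n) ∘ₗ bosonicForm

/-- Left multiplication by `∑ aᵢ θᵢ`. -/
noncomputable def mulTheta : (Fin n → ℂ) →ₗ[ℂ] Module.End ℂ (Superspace n) :=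
  LinearMap.mul ℂ (Superspace n) ∘ₗ fermionicForm

/-- The derivation `∑ lᵢ ∂ᵢ`. -/
noncomputable def derivX : (Fin n → ℂ) →ₗ[ℂ] Module.End ℂ (Superspace n) :=
  superOp n ∘ₗ bosonicForm

/-- The contraction `∑ lᵢ ∂ᵢ^θ`. -/
noncomputable def derivTheta : (Fin n → ℂ) →ₗ[ℂ] Module.End ℂ (Superspace n) :=
  superOp n ∘ₗ fermionicForm

theorem bosonicForm_apply (a : Fin n → ℂ) : bosonicForm a = lineForm a ⊗ₜ 1 := rfl

theorem fermionicForm_apply (a : Fin n → ℂ) :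
    fermionicForm a = 1 ⊗ₜ ExteriorAlgebra.ι ℂ a := rfl

theorem mulX_apply (a : Fin n → ℂ) (g : Superspace n) : mulX a g = bosonicForm a * g := rfl

theorem mulTheta_apply (a : Fin n → ℂ) (g : Superspace n) :
    mulTheta a g = fermionicForm a * g := rfl

theorem mulX_tmul (a : Fin n → ℂ) (f : BosonicRing n) (b : FermionicRing n) :
    mulX a (f ⊗ₜ b) = (lineForm a * f) ⊗ₜ b := by
  rw [mulX_apply, bosonicForm_apply, Algebra.TensorProduct.tmul_mul_tmul, one_mul]

theorem mulTheta_tmul (a : Fin n → ℂ) (f : BosonicRing n) (b : FermionicRing n) :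
    mulTheta a (f ⊗ₜ b) = f ⊗ₜ (ExteriorAlgebra.ι ℂ a * b) := by
  rw [mulTheta_apply, fermionicForm_apply, Algebra.TensorProduct.tmul_mul_tmul, one_mul]

/-- The derivation `∑ lᵢ ∂ᵢ` of the polynomial ring. -/
noncomputable def lineDeriv (l : Fin n → ℂ) : Derivation ℂ (BosonicRing n) (BosonicRing n) :=
  ∑ i, l i • pderiv i

theorem lineDeriv_apply (l : Fin n → ℂ) (f : BosonicRing n) :
    lineDeriv l f = ∑ i, l i • pderiv i f := by
  rw [lineDeriv, ← Derivation.coeFnAddMonoidHom_apply, map_sum, Finset.sum_apply]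
  rfl

theorem bosonicOp_lineForm (l : Fin n → ℂ) :
    bosonicOp n (lineForm l) = (lineDeriv l).toLinearMap := by
  refine LinearMap.ext fun f => ?_
  simp only [lineForm, map_sum, ← MvPolynomial.smul_eq_C_mul, map_smul, bosonicOp_X]
  simp [LinearMap.sum_apply, lineDeriv_apply]

theorem lineDeriv_lineForm (l a : Fin n → ℂ) : lineDeriv l (lineForm a) = C (l ⬝ᵥ a) := by
  rw [lineDeriv_apply, dotProduct, map_sum]
  refine Finset.sum_congr rfl fun i _ => ?_
  rw [lineForm, map_sum, Finset.sum_eq_single i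
    (fun j _ hj => by simp [Derivation.leibniz, pderiv_X, hj]) (by simp)]
  simp [Derivation.leibniz, MvPolynomial.smul_eq_C_mul]

/-- Contraction of the exterior algebra against `l`. -/
noncomputable def contract (l : Fin n → ℂ) : Module.End ℂ (FermionicRing n) :=
  CliffordAlgebra.contractLeft (Q := (0 : QuadraticForm ℂ (Fin n → ℂ))) (dotProductEquiv ℂ (Fin n) l)

theorem fermionicOp_ι (l : Fin n → ℂ) :
    fermionicOp n (ExteriorAlgebra.ι ℂ l) = contract l := by
  rw [fermionicOp, ExteriorAlgebra.lift_ι_apply]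
  rfl

theorem contract_ι_mul (l a : Fin n → ℂ) (b : FermionicRing n) :
    contract l (ExteriorAlgebra.ι ℂ a * b) =
      (l ⬝ᵥ a) • b - ExteriorAlgebra.ι ℂ a * contract l b :=
  CliffordAlgebra.contractLeft_ι_mul _ _ _

theorem contract_one (l : Fin n → ℂ) : contract l (1 : FermionicRing n) = 0 :=
  CliffordAlgebra.contractLeft_one (Q := (0 : QuadraticForm ℂ (Fin n → ℂ))) _

theorem derivX_tmul (l : Fin n → ℂ) (f : BosonicRing n) (b : FermionicRing n) :
    derivX l (f ⊗ₜ b) = lineDeriv l f ⊗ₜ b := by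
  change superOp n (bosonicForm l) _ = _
  rw [bosonicForm_apply, superOp_tmul, bosonicOp_lineForm, map_one]
  rfl

theorem derivTheta_tmul (l : Fin n → ℂ) (f : BosonicRing n) (b : FermionicRing n) :
    derivTheta l (f ⊗ₜ b) = f ⊗ₜ contract l b := by
  change superOp n (fermionicForm l) _ = _
  rw [fermionicForm_apply, superOp_tmul, bosonicOp_one, fermionicOp_ι]
  rfl

/-! ### Commutation relations -/

theorem derivX_mulX (l a : Fin n → ℂ) (g : Superspace n) :
    derivX l (mulX a g) = (l ⬝ᵥ a) • g + mulX a (derivX l g) := by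
  induction g using TensorProduct.induction_on with
  | zero => simp
  | add g g' h h' => simp only [map_add, h, h', smul_add]; abel
  | tmul f b =>
    rw [mulX_tmul, derivX_tmul, derivX_tmul, mulX_tmul, Derivation.leibniz, lineDeriv_lineForm,
      TensorProduct.smul_tmul', ← TensorProduct.add_tmul, smul_eq_mul, smul_eq_mul,
      MvPolynomial.smul_eq_C_mul, mul_comm f, add_comm]

theorem derivTheta_mulTheta (l a : Fin n → ℂ) (g : Superspace n) :
    derivTheta l (mulTheta a g) = (l ⬝ᵥ a) • g - mulTheta a (derivTheta l g) := by
  induction g using TensorProduct.induction_on with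
  | zero => simp
  | add g g' h h' => simp only [map_add, h, h', smul_add]; abel
  | tmul f b =>
    rw [mulTheta_tmul, derivTheta_tmul, derivTheta_tmul, mulTheta_tmul, contract_ι_mul,
      TensorProduct.tmul_sub, TensorProduct.tmul_smul]

theorem derivX_mulTheta (l a : Fin n → ℂ) (g : Superspace n) :
    derivX l (mulTheta a g) = mulTheta a (derivX l g) := by
  induction g using TensorProduct.induction_on with
  | zero => simp
  | add g g' h h' => simp only [map_add, h, h']
  | tmul f b => simp only [mulTheta_tmul, derivX_tmul]

theorem derivTheta_mulX (l a : Fin n → ℂ) (g : Superspace n) :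
    derivTheta l (mulX a g) = mulX a (derivTheta l g) := by
  induction g using TensorProduct.induction_on with
  | zero => simp
  | add g g' h h' => simp only [map_add, h, h']
  | tmul f b => simp only [mulX_tmul, derivTheta_tmul]

theorem mulX_comm (a a' : Fin n → ℂ) (g : Superspace n) :
    mulX a (mulX a' g) = mulX a' (mulX a g) := by
  induction g using TensorProduct.induction_on with
  | zero => simp
  | add g g' h h' => simp only [map_add, h, h']
  | tmul f b => rw [mulX_tmul, mulX_tmul, mulX_tmul, mulX_tmul, mul_left_comm]

theorem mulX_mulTheta (a a' : Fin n → ℂ) (g : Superspace n) :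
    mulX a (mulTheta a' g) = mulTheta a' (mulX a g) := by
  induction g using TensorProduct.induction_on with
  | zero => simp
  | add g g' h h' => simp only [map_add, h, h']
  | tmul f b => simp only [mulX_tmul, mulTheta_tmul]

theorem ι_mul_ι_comm (a b : Fin n → ℂ) :
    ExteriorAlgebra.ι ℂ a * ExteriorAlgebra.ι ℂ b =
      -(ExteriorAlgebra.ι ℂ b * ExteriorAlgebra.ι ℂ a) :=
  eq_neg_of_add_eq_zero_left (ExteriorAlgebra.ι_add_mul_swap a b)

theorem mulTheta_anticomm (a a' : Fin n → ℂ) (g : Superspace n) :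
    mulTheta a (mulTheta a' g) = - mulTheta a' (mulTheta a g) := by
  induction g using TensorProduct.induction_on with
  | zero => simp
  | add g g' h h' => simp only [map_add, h, h']; abel
  | tmul f b =>
    rw [mulTheta_tmul, mulTheta_tmul, mulTheta_tmul, mulTheta_tmul, ← mul_assoc, ← mul_assoc,
      ι_mul_ι_comm, neg_mul, TensorProduct.tmul_neg]

theorem mulTheta_self (a : Fin n → ℂ) (g : Superspace n) : mulTheta a (mulTheta a g) = 0 := by
  induction g using TensorProduct.induction_on with
  | zero => simp
  | add g g' h h' => simp only [map_add, h, h', add_zero]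
  | tmul f b =>
    rw [mulTheta_tmul, mulTheta_tmul, ← mul_assoc, ExteriorAlgebra.ι_sq_zero, zero_mul,
      TensorProduct.tmul_zero]

theorem derivX_pow_mulX_of_eq_zero {l a : Fin n → ℂ} (h : l ⬝ᵥ a = 0) (k : ℕ)
    (g : Superspace n) : (derivX l ^ k) (mulX a g) = mulX a ((derivX l ^ k) g) := by
  induction k with
  | zero => rfl
  | succ k ih =>
    rw [pow_succ', Module.End.mul_apply, ih, derivX_mulX, h, zero_smul, zero_add,
      Module.End.mul_apply]

theorem derivX_pow_mulTheta (l a : Fin n → ℂ) (k : ℕ) (g : Superspace n) :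
    (derivX l ^ k) (mulTheta a g) = mulTheta a ((derivX l ^ k) g) := by
  induction k with
  | zero => rfl
  | succ k ih =>
    rw [pow_succ', Module.End.mul_apply, ih, derivX_mulTheta, Module.End.mul_apply]

/-- Since `∂_l` and `x_a` have a scalar commutator, only one derivative can hit the factor. The
coefficient is nonzero in characteristic zero when `l ⬝ᵥ a ≠ 0`, which is what makes cancellation of
`x_a` possible later. -/
theorem derivX_pow_succ_mulX (l a : Fin n → ℂ) (k : ℕ) (g : Superspace n) :
    (derivX l ^ (k + 1)) (mulX a g) =
      ((k + 1 : ℕ) * (l ⬝ᵥ a)) • (derivX l ^ k) g + mulX a ((derivX l ^ (k + 1)) g) := by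
  induction k generalizing g with
  | zero => simpa using derivX_mulX l a g
  | succ k ih =>
    rw [pow_succ, Module.End.mul_apply, derivX_mulX, map_add, map_smul, ih,
      ← Module.End.mul_apply (derivX l ^ k), ← Module.End.mul_apply (derivX l ^ (k + 1)),
      ← pow_succ, ← pow_succ, ← add_assoc, ← add_smul, Nat.cast_succ (k + 1), add_mul, one_mul,
      add_comm (l ⬝ᵥ a)]

/-! ### Euler identities -/

theorem tmul_mem_bidegree {p : ℕ × ℕ} {f : BosonicRing n} (hf : f.IsHomogeneous p.1)
    {b : FermionicRing n} (hb : b ∈ ⋀[ℂ]^(p.2) (Fin n → ℂ)) : f ⊗ₜ b ∈ bidegree n p :=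
  Submodule.apply_mem_map₂ _ hf hb

@[elab_as_elim]
theorem bidegree_induction {p : ℕ × ℕ} {C : (g : Superspace n) → g ∈ bidegree n p → Prop}
    (tmul : ∀ f : BosonicRing n, ∀ hf : f.IsHomogeneous p.1, ∀ b, ∀ hb : b ∈ ⋀[ℂ]^(p.2) (Fin n → ℂ),
      C (f ⊗ₜ b) (tmul_mem_bidegree hf hb)) (zero : C 0 (zero_mem _))
    (add : ∀ g h hg hh, C g hg → C h hh → C (g + h) (add_mem hg hh))
    {g : Superspace n} (hg : g ∈ bidegree n p) : C g hg := by
  suffices h : ∃ hg, C g hg from h.2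
  refine Submodule.iSup_induction _ (motive := fun g => ∃ hg, C g hg) hg ?_ ⟨_, zero⟩ ?_
  · rintro ⟨f, hf⟩ _ ⟨b, hb, rfl⟩
    exact ⟨_, tmul f hf b hb⟩
  · rintro g h ⟨hg, hCg⟩ ⟨hh, hCh⟩
    exact ⟨_, add g h hg hh hCg hCh⟩

theorem lineForm_single (k : Fin n) : lineForm (Pi.single k 1) = X k := by
  rw [lineForm, Finset.sum_eq_single k (fun j _ hj => by simp [hj]) (by simp)]
  simp

theorem lineDeriv_single (k : Fin n) : lineDeriv (Pi.single k 1) = pderiv k := by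
  rw [lineDeriv, Finset.sum_eq_single k (fun j _ hj => by
    rw [Pi.single_eq_of_ne hj, zero_smul]) (by simp)]
  rw [Pi.single_eq_same, one_smul]

/-- Together with its fermionic analogue, this recovers an element of positive degree from its first
derivatives. It is used for the empty list of vectors and for the nondegeneracy of the pairing. -/
theorem sum_mulX_derivX {p : ℕ × ℕ} {g : Superspace n} (hg : g ∈ bidegree n p) :
    ∑ k, mulX (Pi.single k 1) (derivX (Pi.single k 1) g) = (p.1 : ℂ) • g := by
  induction hg using bidegree_induction with
  | zero => simp
  | add g h _ _ hg hh => simp only [map_add, Finset.sum_add_distrib, hg, hh, smul_add]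
  | tmul f hf b hb =>
    simp only [derivX_tmul, mulX_tmul, lineForm_single, lineDeriv_single,
      ← TensorProduct.sum_tmul]
    rw [hf.sum_X_mul_pderiv, TensorProduct.smul_tmul', Nat.cast_smul_eq_nsmul]

theorem sum_ι_mul_contract {j : ℕ} {b : FermionicRing n} (hb : b ∈ ⋀[ℂ]^j (Fin n → ℂ)) :
    ∑ k : Fin n, ExteriorAlgebra.ι ℂ (Pi.single k 1) * contract (Pi.single k 1) b =
      (j : ℂ) • b := by
  induction j generalizing b with
  | zero =>
    obtain ⟨c, rfl⟩ := Submodule.mem_one.mp (by simpa using hb)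
    simp [Algebra.algebraMap_eq_smul_one, contract_one]
  | succ j ih =>
    change b ∈ LinearMap.range (ExteriorAlgebra.ι ℂ) ^ (j + 1) at hb
    rw [pow_succ'] at hb
    refine Submodule.mul_induction_on hb ?_ ?_
    · rintro _ ⟨a, rfl⟩ c hc
      simp only [contract_ι_mul, mul_sub, Finset.sum_sub_distrib, ← mul_assoc]
      have h1 : ∑ k : Fin n, ExteriorAlgebra.ι ℂ (Pi.single k (1 : ℂ)) *
          ((Pi.single k 1 ⬝ᵥ a) • c) = ExteriorAlgebra.ι ℂ a * c := by
        conv_rhs => rw [pi_eq_sum_univ' a, map_sum, Finset.sum_mul]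
        refine Finset.sum_congr rfl fun k _ => ?_
        rw [map_smul, smul_mul_assoc, mul_smul_comm, single_one_dotProduct]
      -- The sign from moving `θ_k` past `a(θ)` will cancel the sign in the contraction rule, so the
      -- degree grows by one.
      have h2 : ∑ k : Fin n, ExteriorAlgebra.ι ℂ (Pi.single k (1 : ℂ)) *
          ExteriorAlgebra.ι ℂ a * contract (Pi.single k 1) c =
          - ((j : ℂ) • (ExteriorAlgebra.ι ℂ a * c)) := by
        rw [← mul_smul_comm, ← ih hc, Finset.mul_sum, ← Finset.sum_neg_distrib]
        refine Finset.sum_congr rfl fun k _ => ?_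
        rw [ι_mul_ι_comm, neg_mul, mul_assoc]
      rw [h1, h2, Nat.cast_succ, add_smul, one_smul, sub_neg_eq_add, add_comm]
    · intro x y hx hy
      simp only [map_add, mul_add, Finset.sum_add_distrib, hx, hy, smul_add]

theorem sum_mulTheta_derivTheta {p : ℕ × ℕ} {g : Superspace n} (hg : g ∈ bidegree n p) :
    ∑ k, mulTheta (Pi.single k 1) (derivTheta (Pi.single k 1) g) = (p.2 : ℂ) • g := by
  induction hg using bidegree_induction with
  | zero => simp
  | add g h _ _ hg hh => simp only [map_add, Finset.sum_add_distrib, hg, hh, smul_add]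
  | tmul f hf b hb =>
    simp only [derivTheta_tmul, mulTheta_tmul, ← TensorProduct.tmul_sum]
    rw [sum_ι_mul_contract hb, TensorProduct.tmul_smul]

end Superspace

/-! ### Families of projections and internal direct sums -/

section Projections

variable {R ι M : Type*} [Ring R] [AddCommGroup M] [Module R M]
  {N : ι → Submodule R M} {π : ι → M →ₗ[R] M}

theorem isInternal_of_projections [DecidableEq ι] (hsame : ∀ p, ∀ g ∈ N p, π p g = g)
    (hne : ∀ p q, p ≠ q → ∀ g ∈ N q, π p g = 0) (htop : ⨆ p, N p = ⊤) :
    DirectSum.IsInternal N := by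
  refine DirectSum.isInternal_submodule_of_iSupIndep_of_iSup_eq_top (fun p => ?_) htop
  rw [Submodule.disjoint_def]
  intro g hg hg'
  rw [← hsame p g hg]
  have : ⨆ q, ⨆ (_ : q ≠ p), N q ≤ LinearMap.ker (π p) :=
    iSup_le fun q => iSup_le fun hq => fun h hh => hne p q hq.symm h hh
  exact this hg'

theorem exists_sum_projections (hsame : ∀ p, ∀ g ∈ N p, π p g = g)
    (hne : ∀ p q, p ≠ q → ∀ g ∈ N q, π p g = 0) (htop : ⨆ p, N p = ⊤) (g : M) :
    ∃ s : Finset ι, ∑ p ∈ s, π p g = g := by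
  obtain ⟨f, hf, hsum⟩ := (Submodule.mem_iSup_iff_exists_finsupp N g).mp (htop ▸ Submodule.mem_top)
  refine ⟨f.support, ?_⟩
  conv_rhs => rw [← hsum]
  refine Finset.sum_congr rfl fun p hp => ?_
  rw [← hsum, Finsupp.sum, map_sum, Finset.sum_eq_single p
    (fun q _ hq => hne p q hq.symm _ (hf q)) (fun h => absurd hp h), hsame p _ (hf p)]

theorem projection_mem (hsame : ∀ p, ∀ g ∈ N p, π p g = g)
    (hne : ∀ p q, p ≠ q → ∀ g ∈ N q, π p g = 0) (htop : ⨆ p, N p = ⊤) (p : ι) (g : M) :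
    π p g ∈ N p := by
  have hg : g ∈ ⨆ p, N p := htop ▸ Submodule.mem_top
  induction hg using Submodule.iSup_induction' with
  | mem q g hg =>
    by_cases h : p = q
    · subst h; rwa [hsame p g hg]
    · rw [hne p q h g hg]; exact zero_mem _
  | zero => rw [map_zero]; exact zero_mem _
  | add g h _ _ hg hh => rw [map_add]; exact add_mem hg hh

theorem isInternal_comap_subtype [DecidableEq ι] (hsame : ∀ p, ∀ g ∈ N p, π p g = g)
    (hne : ∀ p q, p ≠ q → ∀ g ∈ N q, π p g = 0) (htop : ⨆ p, N p = ⊤) {V : Submodule R M}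
    (hV : ∀ p, ∀ g ∈ V, π p g ∈ V) :
    DirectSum.IsInternal fun p => (N p).comap V.subtype := by
  refine isInternal_of_projections (π := fun p => (π p).restrict (hV p))
    (fun p g hg => Subtype.ext (hsame p _ hg))
    (fun p q hpq g hg => Subtype.ext (hne p q hpq _ hg)) (eq_top_iff.mpr fun g _ => ?_)
  obtain ⟨s, hs⟩ := exists_sum_projections hsame hne htop (g : M)
  have : g = ∑ p ∈ s, (π p).restrict (hV p) g :=
    Subtype.ext (by rw [AddSubmonoidClass.coe_finsetSum]; exact hs.symm)
  rw [this]
  exact sum_mem fun p _ => Submodule.mem_iSup_of_mem p (projection_mem hsame hne htop p _)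

/-- A quotient inherits the grading because the kernel is stable under the projections: the
projection of `g - h` to the `p`-th piece is `g` when `h` lies in the other pieces. -/
theorem isInternal_map_of_ker [DecidableEq ι] {M' : Type*} [AddCommGroup M'] [Module R M']
    (hsame : ∀ p, ∀ g ∈ N p, π p g = g)
    (hne : ∀ p q, p ≠ q → ∀ g ∈ N q, π p g = 0) (htop : ⨆ p, N p = ⊤) (f : M →ₗ[R] M')
    (hf : Function.Surjective f) (hV : ∀ p, ∀ g, f g = 0 → f (π p g) = 0) :
    DirectSum.IsInternal fun p => (N p).map f := by
  refine DirectSum.isInternal_submodule_of_iSupIndep_of_iSup_eq_top (fun p => ?_) ?_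
  · rw [Submodule.disjoint_def]
    rintro _ ⟨g, hg, rfl⟩ hg'
    have h1 : ⨆ q, ⨆ (_ : q ≠ p), (N q).map f = (⨆ q, ⨆ (_ : q ≠ p), N q).map f := by
      simp only [Submodule.map_iSup]
    rw [h1] at hg'
    obtain ⟨h, hh, hfh⟩ := hg'
    have h2 : ⨆ q, ⨆ (_ : q ≠ p), N q ≤ LinearMap.ker (π p) :=
      iSup_le fun q => iSup_le fun hq => fun h hh => hne p q hq.symm h hh
    have h3 := hV p (g - h) (by rw [map_sub, hfh, sub_self])
    rwa [map_sub, h2 hh, sub_zero, hsame p g hg] at h3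
  · rw [← Submodule.map_iSup, htop, Submodule.map_top, LinearMap.range_eq_top.mpr hf]

end Projections

namespace Superspace

open MvPolynomial Multiarrangement

variable {n : ℕ}

/-! ### The bigrading of superspace -/

/-- The projection of superspace onto its piece of bidegree `p`. -/
noncomputable def bigradedProj (p : ℕ × ℕ) : Superspace n →ₗ[ℂ] Superspace n :=
  TensorProduct.map (homogeneousComponent p.1)
    (GradedAlgebra.proj (fun i : ℕ => ⋀[ℂ]^i (Fin n → ℂ)) p.2)

theorem bigradedProj_of_mem {p : ℕ × ℕ} {g : Superspace n} (hg : g ∈ bidegree n p) :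
    bigradedProj p g = g := by
  induction hg using bidegree_induction with
  | zero => exact map_zero _
  | add g h _ _ hg hh => rw [map_add, hg, hh]
  | tmul f hf b hb =>
    rw [bigradedProj, TensorProduct.map_tmul, homogeneousComponent_of_mem hf, if_pos rfl,
      GradedAlgebra.proj_apply, DirectSum.decompose_of_mem_same (fun i : ℕ => ⋀[ℂ]^i (Fin n → ℂ)) hb]

theorem bigradedProj_of_mem_ne {p q : ℕ × ℕ} (h : p ≠ q) {g : Superspace n}
    (hg : g ∈ bidegree n q) : bigradedProj p g = 0 := by
  induction hg using bidegree_induction with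
  | zero => exact map_zero _
  | add g h _ _ hg hh => rw [map_add, hg, hh, add_zero]
  | tmul f hf b hb =>
    rw [bigradedProj, TensorProduct.map_tmul, homogeneousComponent_of_mem hf,
      GradedAlgebra.proj_apply]
    by_cases h1 : p.1 = q.1
    · rw [DirectSum.decompose_of_mem_ne (fun i : ℕ => ⋀[ℂ]^i (Fin n → ℂ)) hb fun h2 => h (Prod.ext h1 h2.symm),
        TensorProduct.tmul_zero]
    · rw [if_neg h1, TensorProduct.zero_tmul]

theorem iSup_bidegree : ⨆ p, bidegree n p = ⊤ := by
  classical
  rw [eq_top_iff]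
  intro g _
  induction g using TensorProduct.induction_on with
  | zero => exact zero_mem _
  | add g h hg hh => exact add_mem (hg trivial) (hh trivial)
  | tmul f b =>
    rw [← sum_homogeneousComponent f,
      ← DirectSum.sum_support_decompose (fun i : ℕ => ⋀[ℂ]^i (Fin n → ℂ)) b,
      TensorProduct.sum_tmul]
    refine sum_mem fun i _ => ?_
    rw [TensorProduct.tmul_sum]
    refine sum_mem fun j _ => Submodule.mem_iSup_of_mem (i, j) ?_
    exact tmul_mem_bidegree (homogeneousComponent_isHomogeneous i f) (SetLike.coe_mem _)

theorem bigradedProj_mem (p : ℕ × ℕ) (g : Superspace n) : bigradedProj p g ∈ bidegree n p :=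
  projection_mem (fun _ _ => bigradedProj_of_mem) (fun _ _ h _ => bigradedProj_of_mem_ne h)
    iSup_bidegree p g

theorem superspace_induction {C : Superspace n → Prop}
    (mem : ∀ p, ∀ g ∈ bidegree n p, C g) (add : ∀ g h, C g → C h → C (g + h))
    (g : Superspace n) : C g := by
  have hg : g ∈ ⨆ p, bidegree n p := iSup_bidegree (n := n) ▸ Submodule.mem_top
  exact Submodule.iSup_induction _ (motive := C) hg mem (mem 0 0 (zero_mem _)) add

theorem mul_mem_bidegree {p q : ℕ × ℕ} {g h : Superspace n} (hg : g ∈ bidegree n p)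
    (hh : h ∈ bidegree n q) : g * h ∈ bidegree n (p + q) := by
  induction hg using bidegree_induction with
  | zero => rw [zero_mul]; exact zero_mem _
  | add g g' _ _ hg hg' => rw [add_mul]; exact add_mem hg hg'
  | tmul f hf b hb =>
    induction hh using bidegree_induction with
    | zero => rw [mul_zero]; exact zero_mem _
    | add g g' _ _ hg hg' => rw [mul_add]; exact add_mem hg hg'
    | tmul f' hf' b' hb' =>
      rw [Algebra.TensorProduct.tmul_mul_tmul]
      refine tmul_mem_bidegree (hf.mul hf') ?_
      have := SetLike.mul_mem_graded (A := fun i : ℕ => ⋀[ℂ]^i (Fin n → ℂ)) hb hb'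
      exact this

theorem one_mem_bidegree : (1 : Superspace n) ∈ bidegree n 0 := by
  refine tmul_mem_bidegree (isHomogeneous_one _ _) ?_
  exact SetLike.one_mem_graded (A := fun i : ℕ => ⋀[ℂ]^i (Fin n → ℂ))

theorem bosonicForm_mem (a : Fin n → ℂ) : bosonicForm a ∈ bidegree n (1, 0) := by
  refine tmul_mem_bidegree ?_ (SetLike.one_mem_graded (A := fun i : ℕ => ⋀[ℂ]^i (Fin n → ℂ)))
  exact IsHomogeneous.sum _ _ _ fun k _ => isHomogeneous_C_mul_X _ _

theorem fermionicForm_mem (a : Fin n → ℂ) : fermionicForm a ∈ bidegree n (0, 1) := by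
  refine tmul_mem_bidegree (isHomogeneous_one _ _) ?_
  change ExteriorAlgebra.ι ℂ a ∈ LinearMap.range (ExteriorAlgebra.ι ℂ) ^ 1
  rw [pow_one]
  exact ⟨a, rfl⟩

theorem mulX_mem (a : Fin n → ℂ) {i j : ℕ} {g : Superspace n} (hg : g ∈ bidegree n (i, j)) :
    mulX a g ∈ bidegree n (i + 1, j) := by
  have := mul_mem_bidegree (bosonicForm_mem a) hg
  rwa [Prod.mk_add_mk, zero_add, add_comm] at this

theorem mulTheta_mem (a : Fin n → ℂ) {i j : ℕ} {g : Superspace n} (hg : g ∈ bidegree n (i, j)) :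
    mulTheta a g ∈ bidegree n (i, j + 1) := by
  have := mul_mem_bidegree (fermionicForm_mem a) hg
  rwa [Prod.mk_add_mk, zero_add, add_comm 1] at this

theorem lineDeriv_isHomogeneous (l : Fin n → ℂ) {i : ℕ} {f : BosonicRing n}
    (hf : f.IsHomogeneous i) : (lineDeriv l f).IsHomogeneous (i - 1) := by
  rw [lineDeriv_apply]
  refine IsHomogeneous.sum _ _ _ fun k _ => ?_
  rw [MvPolynomial.smul_eq_C_mul]
  exact hf.pderiv.C_mul _

theorem derivX_mem (l : Fin n → ℂ) {i j : ℕ} {g : Superspace n}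
    (hg : g ∈ bidegree n (i + 1, j)) : derivX l g ∈ bidegree n (i, j) := by
  induction hg using bidegree_induction with
  | zero => rw [map_zero]; exact zero_mem _
  | add g h _ _ hg hh => rw [map_add]; exact add_mem hg hh
  | tmul f hf b hb =>
    rw [derivX_tmul]
    exact tmul_mem_bidegree (lineDeriv_isHomogeneous l hf) hb

theorem derivX_eq_zero (l : Fin n → ℂ) {j : ℕ} {g : Superspace n}
    (hg : g ∈ bidegree n (0, j)) : derivX l g = 0 := by
  induction hg using bidegree_induction with
  | zero => rw [map_zero]
  | add g h _ _ hg hh => rw [map_add, hg, hh, add_zero]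
  | tmul f hf b hb =>
    rw [derivX_tmul, lineDeriv_apply]
    obtain ⟨c, rfl⟩ : ∃ c, f = C c := ⟨_, (totalDegree_eq_zero_iff_eq_C.mp
      (Nat.le_zero.mp hf.totalDegree_le))⟩
    simp

theorem contract_mem (l : Fin n → ℂ) {j : ℕ} {b : FermionicRing n}
    (hb : b ∈ ⋀[ℂ]^(j + 1) (Fin n → ℂ)) : contract l b ∈ ⋀[ℂ]^j (Fin n → ℂ) := by
  induction j generalizing b with
  | zero =>
    change b ∈ LinearMap.range (ExteriorAlgebra.ι ℂ) ^ 1 at hb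
    rw [pow_one] at hb
    obtain ⟨a, rfl⟩ := hb
    have := contract_ι_mul l a 1
    rw [mul_one, contract_one, mul_zero, sub_zero] at this
    rw [this]
    exact Submodule.smul_mem _ _ (SetLike.one_mem_graded (A := fun i : ℕ => ⋀[ℂ]^i (Fin n → ℂ)))
  | succ j ih =>
    change b ∈ LinearMap.range (ExteriorAlgebra.ι ℂ) ^ (j + 1 + 1) at hb
    rw [pow_succ'] at hb
    refine Submodule.mul_induction_on hb ?_ ?_
    · rintro _ ⟨a, rfl⟩ c hc
      rw [contract_ι_mul]
      refine sub_mem (Submodule.smul_mem _ _ hc) ?_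
      change _ ∈ LinearMap.range (ExteriorAlgebra.ι ℂ) ^ (j + 1)
      rw [pow_succ']
      exact Submodule.mul_mem_mul ⟨a, rfl⟩ (ih hc)
    · intro x y hx hy
      rw [map_add]
      exact add_mem hx hy

theorem derivTheta_mem (l : Fin n → ℂ) {i j : ℕ} {g : Superspace n}
    (hg : g ∈ bidegree n (i, j + 1)) : derivTheta l g ∈ bidegree n (i, j) := by
  induction hg using bidegree_induction with
  | zero => rw [map_zero]; exact zero_mem _
  | add g h _ _ hg hh => rw [map_add]; exact add_mem hg hh
  | tmul f hf b hb =>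
    rw [derivTheta_tmul]
    exact tmul_mem_bidegree (p := (i, j)) hf (contract_mem (j := j) l hb)

theorem derivTheta_eq_zero (l : Fin n → ℂ) {i : ℕ} {g : Superspace n}
    (hg : g ∈ bidegree n (i, 0)) : derivTheta l g = 0 := by
  induction hg using bidegree_induction with
  | zero => rw [map_zero]
  | add g h _ _ hg hh => rw [map_add, hg, hh, add_zero]
  | tmul f hf b hb =>
    rw [derivTheta_tmul]
    obtain ⟨c, rfl⟩ := Submodule.mem_one.mp (by simpa using hb)
    rw [Algebra.algebraMap_eq_smul_one, map_smul, contract_one, smul_zero,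
      TensorProduct.tmul_zero]

theorem exists_eq_smul_one {g : Superspace n} (hg : g ∈ bidegree n (0, 0)) :
    ∃ c : ℂ, g = c • (1 : Superspace n) := by
  induction hg using bidegree_induction with
  | zero => exact ⟨0, (zero_smul _ _).symm⟩
  | add g h _ _ hg hh =>
    obtain ⟨c, rfl⟩ := hg
    obtain ⟨d, rfl⟩ := hh
    exact ⟨c + d, (add_smul _ _ _).symm⟩
  | tmul f hf b hb =>
    obtain ⟨c, rfl⟩ := Submodule.mem_one.mp (by simpa using hb)
    obtain ⟨d, rfl⟩ : ∃ d, f = C d := ⟨_, (totalDegree_eq_zero_iff_eq_C.mp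
      (Nat.le_zero.mp hf.totalDegree_le))⟩
    refine ⟨c * d, ?_⟩
    rw [Algebra.algebraMap_eq_smul_one, TensorProduct.tmul_smul, mul_smul,
      Algebra.TensorProduct.one_def, TensorProduct.smul_tmul' d, MvPolynomial.smul_eq_C_mul,
      mul_one]

/-! ### Projections and homogeneous operators -/

/-- An operator that shifts the bidegree along an injection commutes with projections. -/
theorem bigradedProj_raise {T : Module.End ℂ (Superspace n)} {s : ℕ × ℕ → ℕ × ℕ}
    (hs : Function.Injective s) (hT : ∀ q, ∀ g ∈ bidegree n q, T g ∈ bidegree n (s q))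
    (p : ℕ × ℕ) (g : Superspace n) : bigradedProj (s p) (T g) = T (bigradedProj p g) := by
  induction g using superspace_induction with
  | add g h hg hh => simp only [map_add, hg, hh]
  | mem q g hg =>
    by_cases h : p = q
    · subst h
      rw [bigradedProj_of_mem hg, bigradedProj_of_mem (hT p g hg)]
    · rw [bigradedProj_of_mem_ne h hg, bigradedProj_of_mem_ne (hs.ne h) (hT q g hg), map_zero]

theorem bigradedProj_raise_eq_zero {T : Module.End ℂ (Superspace n)} {s : ℕ × ℕ → ℕ × ℕ}
    (hT : ∀ q, ∀ g ∈ bidegree n q, T g ∈ bidegree n (s q))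
    {p : ℕ × ℕ} (hp : ∀ q, p ≠ s q) (g : Superspace n) : bigradedProj p (T g) = 0 := by
  induction g using superspace_induction with
  | add g h hg hh => simp only [map_add, hg, hh, add_zero]
  | mem q g hg => exact bigradedProj_of_mem_ne (hp q) (hT q g hg)

/-- An operator that lowers the bidegree along an injection commutes with projections. -/
theorem bigradedProj_lower {T : Module.End ℂ (Superspace n)} {s : ℕ × ℕ → ℕ × ℕ}
    (hT : ∀ q, ∀ g ∈ bidegree n (s q), T g ∈ bidegree n q)
    (hT' : ∀ q, (∀ q', q ≠ s q') → ∀ g ∈ bidegree n q, T g = 0)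
    (p : ℕ × ℕ) (g : Superspace n) : bigradedProj p (T g) = T (bigradedProj (s p) g) := by
  induction g using superspace_induction with
  | add g h hg hh => simp only [map_add, hg, hh]
  | mem q g hg =>
    by_cases h : s p = q
    · subst h
      rw [bigradedProj_of_mem hg, bigradedProj_of_mem (hT p g hg)]
    · rw [bigradedProj_of_mem_ne h hg, map_zero]
      by_cases hq : ∃ q', q = s q'
      · obtain ⟨q', rfl⟩ := hq
        exact bigradedProj_of_mem_ne (fun hpq => h (congrArg s hpq)) (hT q' g hg)
      · rw [hT' q (not_exists.mp hq) g hg, map_zero]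

theorem bigradedProj_succ_mulX (a : Fin n → ℂ) (i j : ℕ) (g : Superspace n) :
    bigradedProj (i + 1, j) (mulX a g) = mulX a (bigradedProj (i, j) g) :=
  bigradedProj_raise (s := fun q => (q.1 + 1, q.2))
    (fun p q h => by simpa [Prod.ext_iff] using h) (fun _ _ hg => mulX_mem a hg) (i, j) g

theorem bigradedProj_zero_mulX (a : Fin n → ℂ) (j : ℕ) (g : Superspace n) :
    bigradedProj (0, j) (mulX a g) = 0 :=
  bigradedProj_raise_eq_zero (s := fun q => (q.1 + 1, q.2))
    (fun _ _ hg => mulX_mem a hg) (fun q => by simp [Prod.ext_iff]) g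

theorem bigradedProj_succ_mulTheta (a : Fin n → ℂ) (i j : ℕ) (g : Superspace n) :
    bigradedProj (i, j + 1) (mulTheta a g) = mulTheta a (bigradedProj (i, j) g) :=
  bigradedProj_raise (s := fun q => (q.1, q.2 + 1))
    (fun p q h => by simpa [Prod.ext_iff] using h) (fun _ _ hg => mulTheta_mem a hg) (i, j) g

theorem bigradedProj_zero_mulTheta (a : Fin n → ℂ) (i : ℕ) (g : Superspace n) :
    bigradedProj (i, 0) (mulTheta a g) = 0 :=
  bigradedProj_raise_eq_zero (s := fun q => (q.1, q.2 + 1))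
    (fun _ _ hg => mulTheta_mem a hg) (fun q => by simp [Prod.ext_iff]) g

theorem bigradedProj_derivX (l : Fin n → ℂ) (p : ℕ × ℕ) (g : Superspace n) :
    bigradedProj p (derivX l g) = derivX l (bigradedProj (p.1 + 1, p.2) g) :=
  bigradedProj_lower (s := fun q => (q.1 + 1, q.2)) (fun _ _ hg => derivX_mem l hg)
    (fun q hq g hg => by
      obtain ⟨_ | i, j⟩ := q
      · exact derivX_eq_zero l hg
      · exact absurd rfl (hq (i, j))) p g

theorem bigradedProj_derivTheta (l : Fin n → ℂ) (p : ℕ × ℕ) (g : Superspace n) :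
    bigradedProj p (derivTheta l g) = derivTheta l (bigradedProj (p.1, p.2 + 1) g) :=
  bigradedProj_lower (s := fun q => (q.1, q.2 + 1)) (fun _ _ hg => derivTheta_mem l hg)
    (fun q hq g hg => by
      obtain ⟨i, _ | j⟩ := q
      · exact derivTheta_eq_zero l hg
      · exact absurd rfl (hq (i, j))) p g

theorem bigradedProj_derivX_pow (l : Fin n → ℂ) (k : ℕ) (p : ℕ × ℕ) (g : Superspace n) :
    bigradedProj p ((derivX l ^ k) g) = (derivX l ^ k) (bigradedProj (p.1 + k, p.2) g) := by
  induction k generalizing p with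
  | zero => rfl
  | succ k ih =>
    rw [pow_succ', Module.End.mul_apply, bigradedProj_derivX, ih, Module.End.mul_apply,
      add_right_comm, add_assoc]

end Superspace

namespace Superspace

variable {n : ℕ}

/-! ### Superpolynomials vanishing on the annihilator of a subspace -/

/-- The ideal of `Ωₙ` generated by the bosonic and fermionic linear forms in `W`. -/
noncomputable def vanishing (W : Submodule ℂ (Fin n → ℂ)) : Submodule ℂ (Superspace n) :=
  Submodule.span ℂ {g | ∃ w ∈ W, ∃ h, g = mulX w h ∨ g = mulTheta w h}

/-- The vector `l` is orthogonal to `W` for the standard bilinear form. -/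
def Perp (W : Submodule ℂ (Fin n → ℂ)) (l : Fin n → ℂ) : Prop := ∀ w ∈ W, l ⬝ᵥ w = 0

theorem mulX_mem_vanishing_of_mem {W : Submodule ℂ (Fin n → ℂ)} {w : Fin n → ℂ} (hw : w ∈ W)
    (h : Superspace n) : mulX w h ∈ vanishing W :=
  Submodule.subset_span ⟨w, hw, h, Or.inl rfl⟩

theorem mulTheta_mem_vanishing_of_mem {W : Submodule ℂ (Fin n → ℂ)} {w : Fin n → ℂ}
    (hw : w ∈ W) (h : Superspace n) : mulTheta w h ∈ vanishing W :=
  Submodule.subset_span ⟨w, hw, h, Or.inr rfl⟩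

theorem apply_mem_of_mem_vanishing {W : Submodule ℂ (Fin n → ℂ)}
    {K : Submodule ℂ (Superspace n)} {T : Module.End ℂ (Superspace n)}
    (hX : ∀ w ∈ W, ∀ h, T (mulX w h) ∈ K) (hT : ∀ w ∈ W, ∀ h, T (mulTheta w h) ∈ K)
    {g : Superspace n} (hg : g ∈ vanishing W) : T g ∈ K := by
  have : vanishing W ≤ K.comap T := by
    refine Submodule.span_le.mpr ?_
    rintro _ ⟨w, hw, h, rfl | rfl⟩
    exacts [hX w hw h, hT w hw h]
  exact this hg

theorem vanishing_mono {W W' : Submodule ℂ (Fin n → ℂ)} (h : W ≤ W') :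
    vanishing W ≤ vanishing W' := fun _ =>
  apply_mem_of_mem_vanishing (T := LinearMap.id) (fun _ hw g => mulX_mem_vanishing_of_mem (h hw) g)
    (fun _ hw g => mulTheta_mem_vanishing_of_mem (h hw) g)

theorem vanishing_bot : vanishing (⊥ : Submodule ℂ (Fin n → ℂ)) = ⊥ := by
  refine le_bot_iff.mp fun _ => apply_mem_of_mem_vanishing (T := LinearMap.id) ?_ ?_ <;>
  · rintro w hw g
    rw [(Submodule.mem_bot ℂ).mp hw, map_zero]
    exact zero_mem _

theorem mulX_mem_vanishing {W : Submodule ℂ (Fin n → ℂ)} (a : Fin n → ℂ) {g : Superspace n}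
    (hg : g ∈ vanishing W) : mulX a g ∈ vanishing W :=
  apply_mem_of_mem_vanishing (fun w hw h => mulX_comm a w h ▸ mulX_mem_vanishing_of_mem hw _)
    (fun w hw h => mulX_mulTheta a w h ▸ mulTheta_mem_vanishing_of_mem hw _) hg

theorem mulTheta_mem_vanishing {W : Submodule ℂ (Fin n → ℂ)} (a : Fin n → ℂ)
    {g : Superspace n} (hg : g ∈ vanishing W) : mulTheta a g ∈ vanishing W :=
  apply_mem_of_mem_vanishing (fun w hw h => mulX_mulTheta w a h ▸ mulX_mem_vanishing_of_mem hw _)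
    (fun w hw h => mulTheta_anticomm a w h ▸ neg_mem (mulTheta_mem_vanishing_of_mem hw _)) hg

theorem derivX_mem_vanishing {W : Submodule ℂ (Fin n → ℂ)} {l : Fin n → ℂ} (hl : Perp W l)
    {g : Superspace n} (hg : g ∈ vanishing W) : derivX l g ∈ vanishing W := by
  refine apply_mem_of_mem_vanishing (fun w hw h => ?_) (fun w hw h => ?_) hg
  · rw [derivX_mulX, hl w hw, zero_smul, zero_add]
    exact mulX_mem_vanishing_of_mem hw _
  · rw [derivX_mulTheta]
    exact mulTheta_mem_vanishing_of_mem hw _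

theorem derivTheta_mem_vanishing {W : Submodule ℂ (Fin n → ℂ)} {l : Fin n → ℂ} (hl : Perp W l)
    {g : Superspace n} (hg : g ∈ vanishing W) : derivTheta l g ∈ vanishing W := by
  refine apply_mem_of_mem_vanishing (fun w hw h => ?_) (fun w hw h => ?_) hg
  · rw [derivTheta_mulX]
    exact mulX_mem_vanishing_of_mem hw _
  · rw [derivTheta_mulTheta, hl w hw, zero_smul, zero_sub]
    exact neg_mem (mulTheta_mem_vanishing_of_mem hw _)

theorem derivX_pow_mem_vanishing {W : Submodule ℂ (Fin n → ℂ)} {l : Fin n → ℂ}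
    (hl : Perp W l) (k : ℕ) {g : Superspace n} (hg : g ∈ vanishing W) :
    (derivX l ^ k) g ∈ vanishing W := by
  induction k with
  | zero => exact hg
  | succ k ih => rw [pow_succ', Module.End.mul_apply]; exact derivX_mem_vanishing hl ih

theorem bigradedProj_mem_vanishing {W : Submodule ℂ (Fin n → ℂ)} (p : ℕ × ℕ)
    {g : Superspace n} (hg : g ∈ vanishing W) : bigradedProj p g ∈ vanishing W := by
  obtain ⟨i, j⟩ := p
  refine apply_mem_of_mem_vanishing (fun w hw h => ?_) (fun w hw h => ?_) hg
  · cases i with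
    | zero => rw [bigradedProj_zero_mulX]; exact zero_mem _
    | succ i => rw [bigradedProj_succ_mulX]; exact mulX_mem_vanishing_of_mem hw _
  · cases j with
    | zero => rw [bigradedProj_zero_mulTheta]; exact zero_mem _
    | succ j => rw [bigradedProj_succ_mulTheta]; exact mulTheta_mem_vanishing_of_mem hw _

theorem exists_of_mem_vanishing_sup {W : Submodule ℂ (Fin n → ℂ)} {a : Fin n → ℂ}
    {g : Superspace n} (hg : g ∈ vanishing (W ⊔ Submodule.span ℂ {a})) :
    ∃ k ∈ vanishing W, ∃ h h', g = k + mulX a h + mulTheta a h' := by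
  have key : g ∈ vanishing W ⊔ LinearMap.range (mulX a) ⊔ LinearMap.range (mulTheta a) := by
    refine apply_mem_of_mem_vanishing (T := LinearMap.id) (fun v hv h => ?_) (fun v hv h => ?_)
      hg <;>
    obtain ⟨w, hw, _, hc, rfl⟩ := Submodule.mem_sup.mp hv <;>
    obtain ⟨c, rfl⟩ := Submodule.mem_span_singleton.mp hc <;>
    rw [LinearMap.id_apply, map_add, map_smul, LinearMap.add_apply]
    · exact add_mem (Submodule.mem_sup_left (Submodule.mem_sup_left
        (mulX_mem_vanishing_of_mem hw h)))
        (Submodule.smul_mem _ c (Submodule.mem_sup_left (Submodule.mem_sup_right ⟨h, rfl⟩)))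
    · exact add_mem (Submodule.mem_sup_left (Submodule.mem_sup_left
        (mulTheta_mem_vanishing_of_mem hw h)))
        (Submodule.smul_mem _ c (Submodule.mem_sup_right ⟨h, rfl⟩))
  obtain ⟨y, hy, _, ⟨h', rfl⟩, rfl⟩ := Submodule.mem_sup.mp key
  obtain ⟨k, hk, _, ⟨h, rfl⟩, rfl⟩ := Submodule.mem_sup.mp hy
  exact ⟨k, hk, h, h', rfl⟩

theorem exists_perp_of_notMem {W : Submodule ℂ (Fin n → ℂ)} {a : Fin n → ℂ} (ha : a ∉ W) :
    ∃ l, Perp W l ∧ l ⬝ᵥ a ≠ 0 := by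
  obtain ⟨f, hf, hW⟩ := W.exists_le_ker_of_notMem ha
  refine ⟨(dotProductEquiv ℂ (Fin n)).symm f, fun w hw => ?_, ?_⟩
  · change dotProductEquiv ℂ (Fin n) _ w = 0
    rw [LinearEquiv.apply_symm_apply]
    exact hW hw
  · change dotProductEquiv ℂ (Fin n) _ a ≠ 0
    rwa [LinearEquiv.apply_symm_apply]

/-- Local nilpotence, from the drop in bosonic degree; it starts the descent in
`mem_vanishing_of_smul_add_mulX`. -/
theorem exists_derivX_pow_eq_zero (l : Fin n → ℂ) (g : Superspace n) :
    ∃ k, (derivX l ^ k) g = 0 := by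
  induction g using superspace_induction with
  | mem p g hg =>
    obtain ⟨i, j⟩ := p
    induction i generalizing g with
    | zero => exact ⟨1, by rw [pow_one]; exact derivX_eq_zero l hg⟩
    | succ i ih =>
      obtain ⟨k, hk⟩ := ih _ (derivX_mem l hg)
      exact ⟨k + 1, by rwa [pow_succ, Module.End.mul_apply]⟩
  | add g h hg hh =>
    obtain ⟨k, hk⟩ := hg
    obtain ⟨k', hk'⟩ := hh
    refine ⟨k + k', ?_⟩
    rw [map_add, pow_add, Module.End.mul_apply, Module.End.mul_apply, hk', map_zero, add_zero,
      ← Module.End.mul_apply, ← pow_add, add_comm, pow_add, Module.End.mul_apply, hk, map_zero]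

/-- The operator `N (l ⬝ a) + X_a ∂_l` with `N > 0` is injective modulo `vanishing W`. -/
theorem mem_vanishing_of_smul_add_mulX {W : Submodule ℂ (Fin n → ℂ)} {l a : Fin n → ℂ}
    (hl : Perp W l) (hla : l ⬝ᵥ a ≠ 0) (N : ℕ) {u : Superspace n}
    (hu : ((N + 1 : ℕ) * (l ⬝ᵥ a)) • u + mulX a (derivX l u) ∈ vanishing W) :
    u ∈ vanishing W := by
  -- Apply `∂_l^k` to the hypothesis. Commuting it past `x_a` contributes `k (l ⬝ᵥ a)`, so modulo
  -- `x_a ∂_l^(k+1) u` the result is `(N + 1 + k)(l ⬝ᵥ a) ∂_l^k u`, with nonzero coefficient.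
  have descend : ∀ k, (derivX l ^ (k + 1)) u ∈ vanishing W →
      (derivX l ^ k) u ∈ vanishing W := by
    intro k hk
    have h1 := derivX_pow_mem_vanishing hl k hu
    have h2 : (derivX l ^ k) (mulX a (derivX l u)) - (k * (l ⬝ᵥ a)) • (derivX l ^ k) u =
        mulX a ((derivX l ^ (k + 1)) u) := by
      cases k with
      | zero => simp
      | succ k =>
        rw [derivX_pow_succ_mulX, pow_succ _ (k + 1), Module.End.mul_apply, pow_succ _ k,
          Module.End.mul_apply]
        exact add_sub_cancel_left _ _
    have h3 := sub_mem h1 (h2 ▸ mulX_mem_vanishing a hk)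
    rw [map_add, map_smul, add_comm, add_sub_sub_cancel, ← add_smul, ← add_mul] at h3
    refine (Submodule.smul_mem_iff _ (mul_ne_zero ?_ hla)).mp h3
    exact_mod_cast (by omega : N + 1 + k ≠ 0)
  obtain ⟨k, hk⟩ := exists_derivX_pow_eq_zero l u
  replace hk : (derivX l ^ k) u ∈ vanishing W := hk ▸ zero_mem _
  induction k with
  | zero => exact hk
  | succ k ih => exact ih (descend k hk)

/-- The hypothesis is the operator of `mem_vanishing_of_smul_add_mulX` with `N = k`, applied to `u =
∂_l^k h`. Cancelling `x_a` costs exactly one derivative, matching the drop of `ρ(l)` when `a` is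
deleted. -/
theorem derivX_pow_mem_vanishing_of_mulX {W : Submodule ℂ (Fin n → ℂ)} {l a : Fin n → ℂ}
    (hl : Perp W l) (hla : l ⬝ᵥ a ≠ 0) (k : ℕ) {h : Superspace n}
    (hh : (derivX l ^ (k + 1)) (mulX a h) ∈ vanishing W) : (derivX l ^ k) h ∈ vanishing W := by
  refine mem_vanishing_of_smul_add_mulX hl hla k ?_
  rwa [← Module.End.mul_apply (derivX l), ← pow_succ', ← derivX_pow_succ_mulX]

/-- Bosonic linear forms outside `W` are regular modulo `vanishing W`. -/
theorem mem_vanishing_of_mulX {W : Submodule ℂ (Fin n → ℂ)} {a : Fin n → ℂ} (ha : a ∉ W)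
    {h : Superspace n} (hh : mulX a h ∈ vanishing W) : h ∈ vanishing W := by
  obtain ⟨l, hl, hla⟩ := exists_perp_of_notMem ha
  exact derivX_pow_mem_vanishing_of_mulX hl hla 0 (derivX_pow_mem_vanishing hl 1 hh)

/-- Modulo the bosonic form `a`, the annihilator of the fermionic form `a ∉ W` is generated
by that form. -/
theorem mem_vanishing_of_mulTheta {W : Submodule ℂ (Fin n → ℂ)} {a : Fin n → ℂ} (ha : a ∉ W)
    {h : Superspace n} (hh : mulTheta a h ∈ vanishing W ⊔ LinearMap.range (mulX a)) :
    h ∈ vanishing (W ⊔ Submodule.span ℂ {a}) := by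
  obtain ⟨l, hl, hla⟩ := exists_perp_of_notMem ha
  have ha' : a ∈ W ⊔ Submodule.span ℂ {a} :=
    Submodule.mem_sup_right (Submodule.mem_span_singleton_self a)
  obtain ⟨k, hk, _, ⟨g, rfl⟩, hkg⟩ := Submodule.mem_sup.mp hh
  -- Contraction against `l` is a homotopy: it expresses `(l ⬝ᵥ a) h` as `∂_l^θ (θ_a h) + θ_a ∂_l^θ
  -- h`, and both terms lie in the larger ideal.
  have h1 := derivTheta_mulTheta l a h
  rw [← hkg, map_add, derivTheta_mulX, eq_sub_iff_add_eq] at h1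
  refine (Submodule.smul_mem_iff _ hla).mp ?_
  rw [← h1]
  exact add_mem (add_mem (vanishing_mono le_sup_left (derivTheta_mem_vanishing hl hk))
    (mulX_mem_vanishing_of_mem ha' _)) (mulTheta_mem_vanishing_of_mem ha' _)

/-! ### Power conditions of a list of vectors, relative to a subspace -/

open Classical in
/-- The number of vectors in a list that are not orthogonal to `l`. -/
noncomputable def listRho (l : Fin n → ℂ) : List (Fin n → ℂ) → ℕ
  | [] => 0
  | a :: L => if l ⬝ᵥ a = 0 then listRho l L else listRho l L + 1

theorem listRho_cons_of_eq {l a : Fin n → ℂ} (h : l ⬝ᵥ a = 0) (L : List (Fin n → ℂ)) :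
    listRho l (a :: L) = listRho l L := if_pos h

theorem listRho_cons_of_ne {l a : Fin n → ℂ} (h : l ⬝ᵥ a ≠ 0) (L : List (Fin n → ℂ)) :
    listRho l (a :: L) = listRho l L + 1 := if_neg h

/-- The superpolynomials that satisfy, modulo `vanishing W`, the differential equations
`∂_l^{ρ(l)+1} g = 0` and `∂_l^{ρ(l)} ∂_l^θ g = 0` for all `l` orthogonal to `W`. -/
noncomputable def powerSolutions (L : List (Fin n → ℂ)) (W : Submodule ℂ (Fin n → ℂ)) :
    Submodule ℂ (Superspace n) where
  carrier := {g | ∀ l, Perp W l → (derivX l ^ (listRho l L + 1)) g ∈ vanishing W ∧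
    (derivX l ^ listRho l L) (derivTheta l g) ∈ vanishing W}
  zero_mem' l _ := by simp only [map_zero, zero_mem, and_self]
  add_mem' hg hh l hl := by
    simp only [map_add]
    exact ⟨add_mem (hg l hl).1 (hh l hl).1, add_mem (hg l hl).2 (hh l hl).2⟩
  smul_mem' c g hg l hl := by
    simp only [map_smul]
    exact ⟨Submodule.smul_mem _ c (hg l hl).1, Submodule.smul_mem _ c (hg l hl).2⟩

theorem vanishing_le_powerSolutions (L : List (Fin n → ℂ)) (W : Submodule ℂ (Fin n → ℂ)) :
    vanishing W ≤ powerSolutions L W := fun _ hg _ hl =>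
  ⟨derivX_pow_mem_vanishing hl _ hg,
    derivX_pow_mem_vanishing hl _ (derivTheta_mem_vanishing hl hg)⟩

theorem powerSolutions_cons_of_mem {L : List (Fin n → ℂ)} {W : Submodule ℂ (Fin n → ℂ)}
    {a : Fin n → ℂ} (ha : a ∈ W) : powerSolutions (a :: L) W ≤ powerSolutions L W := by
  intro g hg l hl
  have := hg l hl
  rwa [listRho_cons_of_eq (hl a ha)] at this

theorem Perp.of_sup {W : Submodule ℂ (Fin n → ℂ)} {a l : Fin n → ℂ}
    (hl : Perp (W ⊔ Submodule.span ℂ {a}) l) : Perp W l ∧ l ⬝ᵥ a = 0 :=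
  ⟨fun w hw => hl w (Submodule.mem_sup_left hw),
    hl a (Submodule.mem_sup_right (Submodule.mem_span_singleton_self a))⟩

/-- Top layer of the filtration: directions orthogonal to `W + ℂa` do not see `a`, so their
exponents are the same for `a :: L` and for `L`. -/
theorem powerSolutions_cons_le_sup (L : List (Fin n → ℂ)) (W : Submodule ℂ (Fin n → ℂ))
    (a : Fin n → ℂ) :
    powerSolutions (a :: L) W ≤ powerSolutions L (W ⊔ Submodule.span ℂ {a}) := by
  intro g hg l hl
  have := hg l hl.of_sup.1
  rw [listRho_cons_of_eq hl.of_sup.2] at this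
  exact ⟨vanishing_mono le_sup_left this.1, vanishing_mono le_sup_left this.2⟩

/-- Bottom layer. If `l ⬝ᵥ a = 0`, then `x_a` commutes with the operators and is cancelled by
regularity; otherwise cancelling it uses up the one derivative by which the exponents of `a :: L`
exceed those of `L`. -/
theorem mem_powerSolutions_of_mulX {L : List (Fin n → ℂ)} {W : Submodule ℂ (Fin n → ℂ)}
    {a : Fin n → ℂ} (ha : a ∉ W) {h : Superspace n} (hh : mulX a h ∈ powerSolutions (a :: L) W) :
    h ∈ powerSolutions L W := by
  intro l hl
  have := hh l hl
  by_cases hla : l ⬝ᵥ a = 0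
  · rw [listRho_cons_of_eq hla, derivTheta_mulX, derivX_pow_mulX_of_eq_zero hla,
      derivX_pow_mulX_of_eq_zero hla] at this
    exact ⟨mem_vanishing_of_mulX ha this.1, mem_vanishing_of_mulX ha this.2⟩
  · rw [listRho_cons_of_ne hla, derivTheta_mulX] at this
    exact ⟨derivX_pow_mem_vanishing_of_mulX hl hla _ this.1,
      derivX_pow_mem_vanishing_of_mulX hl hla _ this.2⟩

/-- Middle layer. For `l` orthogonal to `W + ℂa` the operators commute, up to sign, with `x_a` and
`θ_a`, so the part coming from `k` stays in `vanishing W + x_a Ω`. The rest is `θ_a` times the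
equations for `h`, and `mem_vanishing_of_mulTheta` removes `θ_a`. -/
theorem mem_powerSolutions_of_mulTheta {L : List (Fin n → ℂ)} {W : Submodule ℂ (Fin n → ℂ)}
    {a : Fin n → ℂ} (ha : a ∉ W) {k h : Superspace n}
    (hk : k ∈ vanishing W ⊔ LinearMap.range (mulX a))
    (hh : k + mulTheta a h ∈ powerSolutions (a :: L) W) :
    h ∈ powerSolutions L (W ⊔ Submodule.span ℂ {a}) := by
  intro l hl'
  obtain ⟨hl, hla⟩ := hl'.of_sup
  have hg := hh l hl
  obtain ⟨k', hk', _, ⟨f, rfl⟩, rfl⟩ := Submodule.mem_sup.mp hk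
  rw [listRho_cons_of_eq hla] at hg
  simp only [map_add, derivTheta_mulX, derivTheta_mulTheta, hla, zero_smul, zero_sub, map_neg,
    derivX_pow_mulX_of_eq_zero hla, derivX_pow_mulTheta] at hg
  have hX : ∀ f, mulX a f ∈ vanishing W ⊔ LinearMap.range (mulX a) :=
    fun f => Submodule.mem_sup_right ⟨f, rfl⟩
  constructor
  · refine mem_vanishing_of_mulTheta ha ?_
    refine (add_mem_cancel_left (add_mem (Submodule.mem_sup_left
      (derivX_pow_mem_vanishing hl _ hk')) (hX _))).mp (Submodule.mem_sup_left hg.1)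
  · refine mem_vanishing_of_mulTheta ha (neg_mem_iff.mp ?_)
    refine (add_mem_cancel_left (add_mem (Submodule.mem_sup_left
      (derivX_pow_mem_vanishing hl _ (derivTheta_mem_vanishing hl hk'))) (hX _))).mp
      (Submodule.mem_sup_left hg.2)

/-- An Euler sum uses all coordinate directions, while `S l g` is controlled only for `l` orthogonal
to `W`. Split the identity as a projection `f` onto `W` plus `q`, which kills `W`. The `f` part is
in `K` because `T w` maps into `K`; in the `q` part, transposing `q` onto `S` leaves only directions
orthogonal to `W`. -/
theorem sum_single_mem_of_perp {W : Submodule ℂ (Fin n → ℂ)} {K : Submodule ℂ (Superspace n)}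
    (T S : (Fin n → ℂ) →ₗ[ℂ] Module.End ℂ (Superspace n)) (hT : ∀ w ∈ W, ∀ h, T w h ∈ K)
    (hK : ∀ v, ∀ h ∈ K, T v h ∈ K) {g : Superspace n} (hS : ∀ l, Perp W l → S l g ∈ K) :
    ∑ k, T (Pi.single k 1) (S (Pi.single k 1) g) ∈ K := by
  obtain ⟨f, hf⟩ := W.subtype.exists_leftInverse_of_injective W.ker_subtype
  let q : (Fin n → ℂ) →ₗ[ℂ] (Fin n → ℂ) := LinearMap.id - W.subtype ∘ₗ f
  have hq : ∀ w ∈ W, q w = 0 := fun w hw => by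
    have := congrArg (fun h => h ⟨w, hw⟩) hf
    simp only [LinearMap.comp_apply, Submodule.subtype_apply, LinearMap.id_apply] at this
    simp [q, this]
  have hsplit : ∀ v, T v = T (f v) + T (q v) := fun v => by
    rw [← map_add]; simp [q]
  have hexp : ∀ U : (Fin n → ℂ) →ₗ[ℂ] Module.End ℂ (Superspace n), ∀ v,
      U v = ∑ j, v j • U (Pi.single j 1) := fun U v => by
    conv_lhs => rw [pi_eq_sum_univ' v, map_sum]
    simp only [map_smul]
  -- The vector `fun k => q (Pi.single k 1) j` is the `j`-th row of the matrix of `q`; its product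
  -- with `w` is the `j`-th coordinate of `q w`, which is zero on `W`.
  have hsum : ∑ k, T (q (Pi.single k 1)) (S (Pi.single k 1) g) =
      ∑ j, T (Pi.single j 1) (S (fun k => q (Pi.single k 1) j) g) := by
    have h1 : ∀ k, T (q (Pi.single k 1)) (S (Pi.single k 1) g) =
        ∑ j, q (Pi.single k 1) j • T (Pi.single j 1) (S (Pi.single k 1) g) := fun k => by
      rw [hexp T, LinearMap.sum_apply]
      rfl
    have h2 : ∀ j, T (Pi.single j 1) (S (fun k => q (Pi.single k 1) j) g) =
        ∑ k, q (Pi.single k 1) j • T (Pi.single j 1) (S (Pi.single k 1) g) := fun j => by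
      rw [hexp S, LinearMap.sum_apply, map_sum]
      simp only [LinearMap.smul_apply, map_smul]
    simp only [h1, h2]
    exact Finset.sum_comm
  have hsum' : ∑ k, T (Pi.single k 1) (S (Pi.single k 1) g) =
      ∑ k, T (f (Pi.single k 1)) (S (Pi.single k 1) g) +
        ∑ k, T (q (Pi.single k 1)) (S (Pi.single k 1) g) := by
    rw [← Finset.sum_add_distrib]
    exact Finset.sum_congr rfl fun k _ => by rw [hsplit, LinearMap.add_apply]
  rw [hsum', hsum]
  refine add_mem (sum_mem fun k _ => hT _ (f _).2 _) (sum_mem fun j _ => hK _ _ (hS _ ?_))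
  intro w hw
  have h1 := congrFun (hq w hw) j
  rw [pi_eq_sum_univ' w, map_sum, Finset.sum_apply] at h1
  rw [dotProduct, ← h1.trans (Pi.zero_apply j)]
  refine Finset.sum_congr rfl fun k _ => ?_
  rw [map_smul, Pi.smul_apply, smul_eq_mul, mul_comm]

/-- With no vectors left, all first derivatives along directions orthogonal to `W` vanish modulo
`vanishing W`. The bosonic Euler identity then kills positive bosonic degree, and the fermionic one
kills bosonic degree zero with positive fermionic degree. -/
theorem powerSolutions_nil_inf_bidegree_le {W : Submodule ℂ (Fin n → ℂ)} {p : ℕ × ℕ}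
    (hp : p ≠ 0) : powerSolutions [] W ⊓ bidegree n p ≤ vanishing W := by
  rintro g ⟨hg, hgp⟩
  by_cases h1 : p.1 = 0
  · have h2 : (p.2 : ℂ) ≠ 0 := Nat.cast_ne_zero.mpr fun h2 => hp (Prod.ext h1 h2)
    rw [← Submodule.smul_mem_iff _ h2, ← sum_mulTheta_derivTheta hgp]
    exact sum_single_mem_of_perp _ _ (fun w hw h => mulTheta_mem_vanishing_of_mem hw h)
      (fun v h hh => mulTheta_mem_vanishing v hh) fun l hl => (hg l hl).2
  · rw [← Submodule.smul_mem_iff _ (Nat.cast_ne_zero.mpr h1 : (p.1 : ℂ) ≠ 0),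
      ← sum_mulX_derivX hgp]
    refine sum_single_mem_of_perp _ _ (fun w hw h => mulX_mem_vanishing_of_mem hw h)
      (fun v h hh => mulX_mem_vanishing v hh) fun l hl => ?_
    have := (hg l hl).1
    rwa [listRho, zero_add, pow_one] at this

theorem one_notMem_vanishing (W : Submodule ℂ (Fin n → ℂ)) : (1 : Superspace n) ∉ vanishing W := by
  intro h
  have h1 : bigradedProj (0, 0) (1 : Superspace n) ∈ (⊥ : Submodule ℂ (Superspace n)) :=
    apply_mem_of_mem_vanishing (fun w _ h => by rw [bigradedProj_zero_mulX]; exact zero_mem _)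
      (fun w _ h => by rw [bigradedProj_zero_mulTheta]; exact zero_mem _) h
  rw [Submodule.mem_bot, bigradedProj_of_mem (p := (0, 0)) one_mem_bidegree] at h1
  exact one_ne_zero h1

/-! ### Products of linear forms -/

/-- The span of all products `∏_{a ∈ S} a(x) ∏_{a ∈ T} a(θ)` over disjoint sublists `S`, `T` of a
list of vectors. -/
noncomputable def productSpan : List (Fin n → ℂ) → Submodule ℂ (Superspace n)
  | [] => Submodule.span ℂ {1}
  | a :: L => productSpan L ⊔ (productSpan L).map (mulX a) ⊔ (productSpan L).map (mulTheta a)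

theorem productSpan_le_cons (a : Fin n → ℂ) (L : List (Fin n → ℂ)) :
    productSpan L ≤ productSpan (a :: L) :=
  le_sup_left.trans (b := productSpan L ⊔ (productSpan L).map (mulX a)) le_sup_left

theorem map_mulX_productSpan_le (a : Fin n → ℂ) (L : List (Fin n → ℂ)) :
    (productSpan L).map (mulX a) ≤ productSpan (a :: L) :=
  le_sup_right.trans (b := productSpan L ⊔ (productSpan L).map (mulX a)) le_sup_left

theorem map_mulTheta_productSpan_le (a : Fin n → ℂ) (L : List (Fin n → ℂ)) :
    (productSpan L).map (mulTheta a) ≤ productSpan (a :: L) := le_sup_right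

/-- Each factor of a product absorbs at most one derivative, and only if its vector is not
orthogonal to `l`. In the second equation the contraction has either consumed one such factor or
given zero. -/
theorem derivX_pow_productSpan (L : List (Fin n → ℂ)) (l : Fin n → ℂ) :
    ∀ g ∈ productSpan L, (derivX l ^ (listRho l L + 1)) g = 0 ∧
      (derivX l ^ listRho l L) (derivTheta l g) = 0 := by
  induction L with
  | nil =>
    intro g hg
    obtain ⟨c, rfl⟩ := Submodule.mem_span_singleton.mp hg
    rw [listRho, zero_add, pow_one, map_smul, map_smul, derivX_eq_zero l one_mem_bidegree,
      derivTheta_eq_zero l one_mem_bidegree]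
    simp
  | cons a L ih =>
    have hle : ∀ h ∈ productSpan L, (derivX l ^ (listRho l L + 1 + 1)) h = 0 := fun h hh => by
      rw [pow_succ', Module.End.mul_apply, (ih h hh).1, map_zero]
    have hle' : ∀ h ∈ productSpan L, (derivX l ^ (listRho l L + 1)) (derivTheta l h) = 0 :=
      fun h hh => by rw [pow_succ', Module.End.mul_apply, (ih h hh).2, map_zero]
    intro g hg
    obtain ⟨y, hy, _, ⟨h, hh, rfl⟩, rfl⟩ := Submodule.mem_sup.mp hg
    obtain ⟨k, hk, _, ⟨f, hf, rfl⟩, rfl⟩ := Submodule.mem_sup.mp hy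
    by_cases hla : l ⬝ᵥ a = 0
    · simp only [listRho_cons_of_eq hla, map_add, derivTheta_mulX, derivTheta_mulTheta, hla,
        zero_smul, zero_sub, map_neg, derivX_pow_mulX_of_eq_zero hla, derivX_pow_mulTheta,
        (ih k hk).1, (ih k hk).2, (ih f hf).1, (ih f hf).2, (ih h hh).1, (ih h hh).2, map_zero,
        neg_zero, add_zero, and_self]
    · simp only [listRho_cons_of_ne hla, map_add, derivTheta_mulX, derivTheta_mulTheta, map_sub,
        map_smul, derivX_pow_succ_mulX, derivX_pow_mulTheta, hle k hk, hle' k hk, hle f hf,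
        hle' f hf, hle h hh, hle' h hh, (ih f hf).1, (ih f hf).2, (ih h hh).1, map_zero,
        smul_zero, sub_zero, add_zero, and_self]

theorem productSpan_le_powerSolutions (L : List (Fin n → ℂ)) :
    productSpan L ≤ powerSolutions L ⊥ := fun g hg l _ => by
  rw [(derivX_pow_productSpan L l g hg).1, (derivX_pow_productSpan L l g hg).2]
  exact ⟨zero_mem _, zero_mem _⟩

end Superspace

/-! ### Dimensions modulo a subspace -/

section RelativeDimension

variable {M : Type*} [AddCommGroup M] [Module ℂ M]

/-- The dimension of the image of `B` in the quotient by `K`. -/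
noncomputable def dimModulo (K B : Submodule ℂ M) : ℕ := Module.finrank ℂ (B.map K.mkQ)

theorem finrank_map_add_finrank_inf_ker {M' : Type*} [AddCommGroup M'] [Module ℂ M']
    (f : M →ₗ[ℂ] M') (B : Submodule ℂ M) [Module.Finite ℂ B] :
    Module.finrank ℂ (B.map f) + Module.finrank ℂ (B ⊓ LinearMap.ker f : Submodule ℂ M) =
      Module.finrank ℂ B := by
  have h := LinearMap.finrank_range_add_finrank_ker (f ∘ₗ B.subtype)
  rw [LinearMap.range_comp, Submodule.range_subtype, LinearMap.ker_comp] at h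
  rw [← h, add_right_inj, ← Submodule.map_comap_subtype B, Submodule.finrank_map_subtype_eq]

theorem dimModulo_add_finrank_inf (K B : Submodule ℂ M) [Module.Finite ℂ B] :
    dimModulo K B + Module.finrank ℂ (B ⊓ K : Submodule ℂ M) = Module.finrank ℂ B := by
  have h := finrank_map_add_finrank_inf_ker K.mkQ B
  rwa [Submodule.ker_mkQ] at h

theorem finite_of_le {B C : Submodule ℂ M} [Module.Finite ℂ C] (h : B ≤ C) :
    Module.Finite ℂ B := Submodule.finiteDimensional_of_le h

theorem dimModulo_eq_add {K K' : Submodule ℂ M} (h : K ≤ K') (B : Submodule ℂ M)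
    [Module.Finite ℂ B] : dimModulo K B = dimModulo K' B + dimModulo K (B ⊓ K') := by
  have : Module.Finite ℂ (B ⊓ K' : Submodule ℂ M) := finite_of_le inf_le_left
  have h1 := dimModulo_add_finrank_inf K B
  have h2 := dimModulo_add_finrank_inf K' B
  have h3 := dimModulo_add_finrank_inf K (B ⊓ K')
  rw [inf_assoc, inf_eq_right.mpr h] at h3
  omega

theorem dimModulo_mono {K B C : Submodule ℂ M} [Module.Finite ℂ C] (h : B ≤ C ⊔ K) :
    dimModulo K B ≤ dimModulo K C := by
  refine Submodule.finrank_mono ((Submodule.map_mono h).trans (le_of_eq ?_))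
  rw [Submodule.map_sup, Submodule.mkQ_map_self, sup_bot_eq]

theorem dimModulo_map_le {K K' C : Submodule ℂ M} [Module.Finite ℂ C] {T : Module.End ℂ M}
    (hT : K' ≤ K.comap T) : dimModulo K (C.map T) ≤ dimModulo K' C := by
  have h : (C.map T).map K.mkQ = (C.map K'.mkQ).map (K'.mapQ K T hT) := by
    rw [← Submodule.map_comp, ← Submodule.map_comp, Submodule.mapQ_mkQ]
  rw [dimModulo, h]
  exact Submodule.finrank_map_le _ _

theorem le_dimModulo_map {K K' C : Submodule ℂ M} [Module.Finite ℂ C] {T : Module.End ℂ M}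
    (hT : K.comap T ≤ K') : dimModulo K' C ≤ dimModulo K (C.map T) := by
  have : Module.Finite ℂ (C ⊓ K' : Submodule ℂ M) := finite_of_le inf_le_left
  have h1 := dimModulo_add_finrank_inf K' C
  have h : (C.map T).map K.mkQ = LinearMap.range (K.mkQ ∘ₗ T ∘ₗ C.subtype) := by
    rw [← Submodule.map_comp, LinearMap.range_comp, LinearMap.range_comp, Submodule.range_subtype,
      ← Submodule.map_comp]
  have h2 := LinearMap.finrank_range_add_finrank_ker (K.mkQ ∘ₗ T ∘ₗ C.subtype)
  rw [← h] at h2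
  have h3 : Module.finrank ℂ (LinearMap.ker (K.mkQ ∘ₗ T ∘ₗ C.subtype)) ≤
      Module.finrank ℂ (C ⊓ K' : Submodule ℂ M) := by
    rw [← Submodule.finrank_map_subtype_eq]
    refine Submodule.finrank_mono ?_
    rintro _ ⟨x, hx, rfl⟩
    exact ⟨x.2, hT ((Submodule.Quotient.mk_eq_zero K).mp hx)⟩
  rw [dimModulo, dimModulo] at *
  omega

theorem dimModulo_bot_right (K : Submodule ℂ M) : dimModulo K ⊥ = 0 := by
  rw [dimModulo, Submodule.map_bot, finrank_bot]

theorem dimModulo_bot_left (B : Submodule ℂ M) : dimModulo ⊥ B = Module.finrank ℂ B :=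
  ((Submodule.equivMapOfInjective _ (LinearMap.ker_eq_bot.mp (Submodule.ker_mkQ ⊥)) B).finrank_eq).symm

/-- Additivity of dimension along `K ≤ K₁ ≤ K'`. The upper bound asks that `X` and `T` be well
defined between the quotients and that their images cover the layers; the companion lower bound asks
that they be injective and land in the layers. -/
theorem dimModulo_le_add_of_filtration {K K₁ K' B C₁ C₂ C₃ : Submodule ℂ M}
    [Module.Finite ℂ B] [Module.Finite ℂ C₁] [Module.Finite ℂ C₂] [Module.Finite ℂ C₃]
    {X T : Module.End ℂ M} (hK : K ≤ K₁) (hK' : K₁ ≤ K') (h₁ : B ⊓ K₁ ≤ C₁.map X ⊔ K)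
    (hX : K ≤ K.comap X) (h₂ : B ⊓ K' ≤ C₂.map T ⊔ K₁) (hT : K' ≤ K₁.comap T) (h₃ : B ≤ C₃) :
    dimModulo K B ≤ dimModulo K C₁ + dimModulo K' C₃ + dimModulo K' C₂ := by
  have e1 := dimModulo_eq_add hK B
  have e2 := dimModulo_eq_add hK' B
  have i1 := (dimModulo_mono h₁).trans (dimModulo_map_le (C := C₁) hX)
  have i2 := (dimModulo_mono h₂).trans (dimModulo_map_le (C := C₂) hT)
  have i3 : dimModulo K' B ≤ dimModulo K' C₃ := dimModulo_mono (h₃.trans le_sup_left)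
  omega

theorem add_le_dimModulo_of_filtration {K K₁ K' B C₁ C₂ C₃ : Submodule ℂ M}
    [Module.Finite ℂ B] [Module.Finite ℂ C₁] [Module.Finite ℂ C₂] [Module.Finite ℂ C₃]
    {X T : Module.End ℂ M} (hK : K ≤ K₁) (hK' : K₁ ≤ K') (h₁ : C₁.map X ≤ B ⊓ K₁)
    (hX : K.comap X ≤ K) (h₂ : C₂.map T ≤ B ⊓ K') (hT : K₁.comap T ≤ K') (h₃ : C₃ ≤ B) :
    dimModulo K C₁ + dimModulo K' C₃ + dimModulo K' C₂ ≤ dimModulo K B := by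
  have : Module.Finite ℂ (B ⊓ K₁ : Submodule ℂ M) := finite_of_le inf_le_left
  have : Module.Finite ℂ (B ⊓ K' : Submodule ℂ M) := finite_of_le inf_le_left
  have e1 := dimModulo_eq_add hK B
  have e2 := dimModulo_eq_add hK' B
  have i1 := (le_dimModulo_map (C := C₁) hX).trans (dimModulo_mono (h₁.trans le_sup_left))
  have i2 := (le_dimModulo_map (C := C₂) hT).trans (dimModulo_mono (h₂.trans le_sup_left))
  have i3 : dimModulo K' C₃ ≤ dimModulo K' B := dimModulo_mono (h₃.trans le_sup_left)
  omega

end RelativeDimension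

namespace Superspace

variable {n : ℕ}

/-! ### Deletion and contraction -/

/-- The piece of superspace of bidegree `p - (1, 0)`. -/
noncomputable def bidegreePredX (n : ℕ) : ℕ × ℕ → Submodule ℂ (Superspace n)
  | (0, _) => ⊥
  | (i + 1, j) => bidegree n (i, j)

/-- The piece of superspace of bidegree `p - (0, 1)`. -/
noncomputable def bidegreePredTheta (n : ℕ) : ℕ × ℕ → Submodule ℂ (Superspace n)
  | (_, 0) => ⊥
  | (i, j + 1) => bidegree n (i, j)

instance finite_bidegreePredX (p : ℕ × ℕ) : Module.Finite ℂ (bidegreePredX n p) := by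
  obtain ⟨_ | i, j⟩ := p <;> unfold bidegreePredX <;> infer_instance

instance finite_bidegreePredTheta (p : ℕ × ℕ) : Module.Finite ℂ (bidegreePredTheta n p) := by
  obtain ⟨i, _ | j⟩ := p <;> unfold bidegreePredTheta <;> infer_instance

instance finite_inf (V B : Submodule ℂ (Superspace n)) [Module.Finite ℂ B] :
    Module.Finite ℂ (V ⊓ B : Submodule ℂ (Superspace n)) := finite_of_le inf_le_right

theorem mulX_mem_of_bidegreePredX (a : Fin n → ℂ) {p : ℕ × ℕ} {g : Superspace n}
    (hg : g ∈ bidegreePredX n p) : mulX a g ∈ bidegree n p := by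
  obtain ⟨_ | i, j⟩ := p
  · rw [(Submodule.mem_bot ℂ).mp hg, map_zero]; exact zero_mem _
  · exact mulX_mem a hg

theorem mulTheta_mem_of_bidegreePredTheta (a : Fin n → ℂ) {p : ℕ × ℕ} {g : Superspace n}
    (hg : g ∈ bidegreePredTheta n p) : mulTheta a g ∈ bidegree n p := by
  obtain ⟨i, _ | j⟩ := p
  · rw [(Submodule.mem_bot ℂ).mp hg, map_zero]; exact zero_mem _
  · exact mulTheta_mem a hg

theorem exists_bigradedProj_mulX (a : Fin n → ℂ) (p : ℕ × ℕ) (g : Superspace n) :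
    ∃ h ∈ bidegreePredX n p, bigradedProj p (mulX a g) = mulX a h := by
  obtain ⟨_ | i, j⟩ := p
  · exact ⟨0, zero_mem _, by rw [bigradedProj_zero_mulX, map_zero]⟩
  · exact ⟨_, bigradedProj_mem (i, j) g, bigradedProj_succ_mulX a i j g⟩

theorem exists_bigradedProj_mulTheta (a : Fin n → ℂ) (p : ℕ × ℕ) (g : Superspace n) :
    ∃ h ∈ bidegreePredTheta n p, bigradedProj p (mulTheta a g) = mulTheta a h := by
  obtain ⟨i, _ | j⟩ := p
  · exact ⟨0, zero_mem _, by rw [bigradedProj_zero_mulTheta, map_zero]⟩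
  · exact ⟨_, bigradedProj_mem (i, j) g, bigradedProj_succ_mulTheta a i j g⟩

theorem mem_sup_span_singleton (W : Submodule ℂ (Fin n → ℂ)) (a : Fin n → ℂ) :
    a ∈ W ⊔ Submodule.span ℂ {a} :=
  Submodule.mem_sup_right (Submodule.mem_span_singleton_self a)

theorem vanishing_sup_range_le (W : Submodule ℂ (Fin n → ℂ)) (a : Fin n → ℂ) :
    vanishing W ⊔ LinearMap.range (mulX a) ≤ vanishing (W ⊔ Submodule.span ℂ {a}) := by
  refine sup_le (vanishing_mono le_sup_left) ?_
  rintro _ ⟨h, rfl⟩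
  exact mulX_mem_vanishing_of_mem (mem_sup_span_singleton W a) h

/-- Upper half of deletion and contraction. A decomposition of a homogeneous solution along the
filtration need not be homogeneous, so it is first projected to bidegree `p`; this makes the
cofactors of `x_a` and `θ_a` homogeneous of the shifted degree. -/
theorem dimModulo_powerSolutions_cons_le (L : List (Fin n → ℂ)) {W : Submodule ℂ (Fin n → ℂ)}
    {a : Fin n → ℂ} (ha : a ∉ W) (p : ℕ × ℕ) :
    dimModulo (vanishing W) (powerSolutions (a :: L) W ⊓ bidegree n p) ≤
      dimModulo (vanishing W) (powerSolutions L W ⊓ bidegreePredX n p) +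
      dimModulo (vanishing (W ⊔ Submodule.span ℂ {a}))
        (powerSolutions L (W ⊔ Submodule.span ℂ {a}) ⊓ bidegree n p) +
      dimModulo (vanishing (W ⊔ Submodule.span ℂ {a}))
        (powerSolutions L (W ⊔ Submodule.span ℂ {a}) ⊓ bidegreePredTheta n p) := by
  refine dimModulo_le_add_of_filtration (K₁ := vanishing W ⊔ LinearMap.range (mulX a))
    (X := mulX a) (T := mulTheta a) le_sup_left (vanishing_sup_range_le W a) ?_
    (fun g hg => mulX_mem_vanishing a hg) ?_ ?_
    (inf_le_inf_right _ (powerSolutions_cons_le_sup L W a))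
  · rintro g ⟨⟨hg, hgp⟩, hgK⟩
    obtain ⟨k, hk, _, ⟨h, rfl⟩, rfl⟩ := Submodule.mem_sup.mp hgK
    obtain ⟨h', hh', hX⟩ := exists_bigradedProj_mulX a p h
    have hsum := bigradedProj_of_mem hgp
    rw [map_add, hX] at hsum
    have hk' := bigradedProj_mem_vanishing p hk
    rw [← hsum, add_comm]
    refine Submodule.add_mem_sup ⟨h', ⟨mem_powerSolutions_of_mulX ha ?_, hh'⟩, rfl⟩ hk'
    rw [← hsum] at hg
    exact (add_mem_cancel_left (vanishing_le_powerSolutions _ _ hk')).mp hg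
  · rintro g ⟨⟨hg, hgp⟩, hgK⟩
    obtain ⟨k, hk, f, h, rfl⟩ := exists_of_mem_vanishing_sup hgK
    obtain ⟨f', -, hX⟩ := exists_bigradedProj_mulX a p f
    obtain ⟨h', hh', hT⟩ := exists_bigradedProj_mulTheta a p h
    have hsum := bigradedProj_of_mem hgp
    rw [map_add, map_add, hX, hT] at hsum
    have hk' : bigradedProj p k + mulX a f' ∈ vanishing W ⊔ LinearMap.range (mulX a) :=
      Submodule.add_mem_sup (bigradedProj_mem_vanishing p hk) ⟨f', rfl⟩
    rw [← hsum] at hg ⊢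
    rw [add_comm]
    exact Submodule.add_mem_sup
      ⟨h', ⟨mem_powerSolutions_of_mulTheta ha hk' hg, hh'⟩, rfl⟩ hk'
  · intro g hg
    -- Multiplication by `θ_a` sends `vanishing (W + ℂa)` into the middle term, because `θ_a² = 0`
    -- removes the only component outside it.
    obtain ⟨k, hk, f, h, rfl⟩ := exists_of_mem_vanishing_sup hg
    rw [Submodule.mem_comap, map_add, map_add, mulTheta_self, add_zero, ← mulX_mulTheta]
    exact Submodule.add_mem_sup (mulTheta_mem_vanishing a hk) ⟨_, rfl⟩

/-- Lower half, for products. The summands that omit `a`, contain `x_a` or contain `θ_a` feed the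
three layers, and regularity of `x_a` together with the annihilator of `θ_a` gives the injectivity.
-/
theorem le_dimModulo_productSpan_cons (L : List (Fin n → ℂ)) {W : Submodule ℂ (Fin n → ℂ)}
    {a : Fin n → ℂ} (ha : a ∉ W) (p : ℕ × ℕ) :
    dimModulo (vanishing W) (productSpan L ⊓ bidegreePredX n p) +
      dimModulo (vanishing (W ⊔ Submodule.span ℂ {a})) (productSpan L ⊓ bidegree n p) +
      dimModulo (vanishing (W ⊔ Submodule.span ℂ {a})) (productSpan L ⊓ bidegreePredTheta n p) ≤
    dimModulo (vanishing W) (productSpan (a :: L) ⊓ bidegree n p) := by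
  refine add_le_dimModulo_of_filtration (K₁ := vanishing W ⊔ LinearMap.range (mulX a))
    (X := mulX a) (T := mulTheta a) le_sup_left (vanishing_sup_range_le W a) ?_
    (fun g hg => mem_vanishing_of_mulX ha hg) ?_ (fun g hg => mem_vanishing_of_mulTheta ha hg)
    (inf_le_inf_right _ (productSpan_le_cons a L))
  · rintro _ ⟨h, ⟨hh, hp⟩, rfl⟩
    exact ⟨⟨map_mulX_productSpan_le a L ⟨h, hh, rfl⟩, mulX_mem_of_bidegreePredX a hp⟩,
      Submodule.mem_sup_right ⟨h, rfl⟩⟩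
  · rintro _ ⟨h, ⟨hh, hp⟩, rfl⟩
    exact ⟨⟨map_mulTheta_productSpan_le a L ⟨h, hh, rfl⟩,
      mulTheta_mem_of_bidegreePredTheta a hp⟩,
      mulTheta_mem_vanishing_of_mem (mem_sup_span_singleton W a) h⟩

/-- The shift of a bigraded dimension function by one bosonic degree. -/
def shiftX (f : ℕ × ℕ → ℕ) : ℕ × ℕ → ℕ
  | (0, _) => 0
  | (i + 1, j) => f (i, j)

/-- The shift of a bigraded dimension function by one fermionic degree. -/
def shiftTheta (f : ℕ × ℕ → ℕ) : ℕ × ℕ → ℕ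
  | (_, 0) => 0
  | (i, j + 1) => f (i, j)

open Classical in
/-- The bigraded dimension of the solution space, computed by deletion and contraction. -/
noncomputable def recursiveDim :
    List (Fin n → ℂ) → Submodule ℂ (Fin n → ℂ) → ℕ × ℕ → ℕ
  | [], _ => fun p => if p = 0 then 1 else 0
  | a :: L, W =>
    if a ∈ W then recursiveDim L W
    else shiftX (recursiveDim L W) + recursiveDim L (W ⊔ Submodule.span ℂ {a}) +
      shiftTheta (recursiveDim L (W ⊔ Submodule.span ℂ {a}))

/-- The induction must run over all `W`, since contraction enlarges it. -/
theorem dimModulo_powerSolutions_le (L : List (Fin n → ℂ)) (W : Submodule ℂ (Fin n → ℂ))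
    (p : ℕ × ℕ) :
    dimModulo (vanishing W) (powerSolutions L W ⊓ bidegree n p) ≤ recursiveDim L W p := by
  induction L generalizing W p with
  | nil =>
    rw [recursiveDim]
    beta_reduce
    split_ifs with hp
    · subst hp
      have h : powerSolutions [] W ⊓ bidegree n 0 ≤ Submodule.span ℂ {1} ⊔ vanishing W := by
        rintro g ⟨-, hg⟩
        obtain ⟨c, rfl⟩ := exists_eq_smul_one hg
        exact Submodule.mem_sup_left (Submodule.mem_span_singleton.mpr ⟨c, rfl⟩)
      exact (dimModulo_mono h).trans ((Submodule.finrank_map_le _ _).trans (finrank_span_le_card _))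
    · rw [← dimModulo_bot_right (vanishing W)]
      exact dimModulo_mono ((powerSolutions_nil_inf_bidegree_le hp).trans le_sup_right)
  | cons a L ih =>
    rw [recursiveDim]
    split_ifs with ha
    · exact (dimModulo_mono ((inf_le_inf_right _ (powerSolutions_cons_of_mem ha)).trans
        le_sup_left)).trans (ih W p)
    · refine (dimModulo_powerSolutions_cons_le L ha p).trans
        (Nat.add_le_add (Nat.add_le_add ?_ (ih _ p)) ?_)
      · obtain ⟨_ | i, j⟩ := p
        · simp only [bidegreePredX, inf_bot_eq, dimModulo_bot_right, zero_le]
        · exact ih W (i, j)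
      · obtain ⟨i, _ | j⟩ := p
        · simp only [bidegreePredTheta, inf_bot_eq, dimModulo_bot_right, zero_le]
        · exact ih _ (i, j)

theorem le_dimModulo_productSpan (L : List (Fin n → ℂ)) (W : Submodule ℂ (Fin n → ℂ))
    (p : ℕ × ℕ) :
    recursiveDim L W p ≤ dimModulo (vanishing W) (productSpan L ⊓ bidegree n p) := by
  induction L generalizing W p with
  | nil =>
    rw [recursiveDim]
    beta_reduce
    split_ifs with hp
    · subst hp
      rw [Nat.one_le_iff_ne_zero, dimModulo]
      intro h0
      rw [Submodule.finrank_eq_zero, ← le_bot_iff, Submodule.map_le_iff_le_comap,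
        Submodule.comap_bot, Submodule.ker_mkQ] at h0
      exact one_notMem_vanishing W
        (h0 ⟨Submodule.mem_span_singleton_self 1, one_mem_bidegree⟩)
    · exact Nat.zero_le _
  | cons a L ih =>
    rw [recursiveDim]
    split_ifs with ha
    -- For a loop the extra products can simply be discarded, as only a lower bound is needed.
    · exact (ih W p).trans (dimModulo_mono
        ((inf_le_inf_right _ (productSpan_le_cons a L)).trans le_sup_left))
    · refine le_trans (Nat.add_le_add (Nat.add_le_add ?_ (ih _ p)) ?_)
        (le_dimModulo_productSpan_cons L ha p)
      · obtain ⟨_ | i, j⟩ := p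
        · exact Nat.zero_le _
        · exact ih W (i, j)
      · obtain ⟨i, _ | j⟩ := p
        · exact Nat.zero_le _
        · exact ih _ (i, j)

/-- The solution space is spanned by products of linear forms, and its dimensions satisfy the
deletion-contraction recursion. -/
theorem finrank_powerSolutions (L : List (Fin n → ℂ)) (p : ℕ × ℕ) :
    Module.finrank ℂ (powerSolutions L ⊥ ⊓ bidegree n p : Submodule ℂ (Superspace n)) =
      recursiveDim L ⊥ p := by
  have h1 := dimModulo_powerSolutions_le L ⊥ p
  have h2 := le_dimModulo_productSpan L ⊥ p
  rw [vanishing_bot, dimModulo_bot_left] at h1 h2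
  exact le_antisymm h1 (h2.trans (Submodule.finrank_mono
    (inf_le_inf_right _ (productSpan_le_powerSolutions L))))

end Superspace

namespace Superspace

/-! ### Generating functions of bigraded dimensions -/

/-- The generating function of a bigraded dimension function. -/
noncomputable def toSeries (f : ℕ × ℕ → ℕ) : MvPowerSeries (Fin 2) ℤ := fun a => (f (a 0, a 1) : ℤ)

theorem coeff_toSeries (f : ℕ × ℕ → ℕ) (a : Fin 2 →₀ ℕ) :
    MvPowerSeries.coeff a (toSeries f) = f (a 0, a 1) := rfl

theorem toSeries_add (f g : ℕ × ℕ → ℕ) : toSeries (f + g) = toSeries f + toSeries g := by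
  ext a
  rw [map_add, coeff_toSeries, coeff_toSeries, coeff_toSeries, Pi.add_apply, Nat.cast_add]

theorem toSeries_shiftX (f : ℕ × ℕ → ℕ) :
    toSeries (shiftX f) = MvPowerSeries.X 0 * toSeries f := by
  ext a
  rw [MvPowerSeries.X, MvPowerSeries.coeff_monomial_mul, coeff_toSeries, one_mul,
    coeff_toSeries]
  split_ifs with h
  · have h0 : 1 ≤ a 0 := by simpa using h 0
    obtain ⟨k, hk⟩ := Nat.exists_eq_add_of_le' h0
    simp [hk, shiftX]
  · have h0 : a 0 = 0 := by
      by_contra h0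
      exact h (Finsupp.single_le_iff.mpr (Nat.one_le_iff_ne_zero.mpr h0))
    simp [h0, shiftX]

theorem toSeries_shiftTheta (f : ℕ × ℕ → ℕ) :
    toSeries (shiftTheta f) = MvPowerSeries.X 1 * toSeries f := by
  ext a
  rw [MvPowerSeries.X, MvPowerSeries.coeff_monomial_mul, coeff_toSeries, one_mul,
    coeff_toSeries]
  split_ifs with h
  · have h0 : 1 ≤ a 1 := by simpa using h 1
    obtain ⟨k, hk⟩ := Nat.exists_eq_add_of_le' h0
    simp [hk, shiftTheta]
  · have h0 : a 1 = 0 := by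
      by_contra h0
      exact h (Finsupp.single_le_iff.mpr (Nat.one_le_iff_ne_zero.mpr h0))
    simp [h0, shiftTheta]

theorem toSeries_ite_zero : toSeries (fun p => if p = 0 then 1 else 0) = 1 := by
  classical
  ext a
  rw [coeff_toSeries, MvPowerSeries.coeff_one]
  have : ((a 0, a 1) : ℕ × ℕ) = 0 ↔ a = 0 := by
    rw [Prod.mk_eq_zero, DFunLike.ext_iff (f := a) (g := 0), Fin.forall_fin_two]
    rfl
  simp only [this]
  split_ifs <;> rfl

end Superspace

namespace Multiarrangement

variable {ι : Type*} {n : ℕ}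

/-! ### Deletion and contraction for the rank generating function -/

/-- The rank of `X` in the contraction of the arrangement by the subspace `W`. -/
noncomputable def relRk (A : Multiarrangement ι n) (W : Submodule ℂ (Fin n → ℂ)) (X : Finset ι) : ℕ :=
  Module.finrank ℂ (W ⊔ Submodule.span ℂ (A '' (X : Set ι)) : Submodule ℂ (Fin n → ℂ)) -
    Module.finrank ℂ W

theorem relRk_bot (A : Multiarrangement ι n) (X : Finset ι) : A.relRk ⊥ X = A.rk X := by
  rw [relRk, bot_sup_eq, finrank_bot, Nat.sub_zero, rk]

theorem relRk_le_card (A : Multiarrangement ι n) (W : Submodule ℂ (Fin n → ℂ)) (X : Finset ι) :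
    A.relRk W X ≤ X.card := by
  classical
  have h1 := Submodule.finrank_add_le_finrank_add_finrank W
    (Submodule.span ℂ (A '' (X : Set ι)))
  have h2 : Module.finrank ℂ (Submodule.span ℂ (A '' (X : Set ι))) ≤ X.card := by
    rw [← Finset.coe_image]
    exact (finrank_span_finset_le_card _).trans Finset.card_image_le
  rw [relRk]
  omega

variable [DecidableEq ι]

theorem relRk_insert_of_mem (A : Multiarrangement ι n) {W : Submodule ℂ (Fin n → ℂ)} {i : ι}
    (hi : A i ∈ W) (X : Finset ι) : A.relRk W (insert i X) = A.relRk W X := by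
  rw [relRk, relRk, Finset.coe_insert, Set.image_insert_eq, Submodule.span_insert, ← sup_assoc,
    sup_eq_left.mpr ((Submodule.span_singleton_le_iff_mem _ _).mpr hi)]

theorem finrank_sup_span_singleton {W : Submodule ℂ (Fin n → ℂ)} {a : Fin n → ℂ} (ha : a ∉ W) :
    Module.finrank ℂ (W ⊔ Submodule.span ℂ {a} : Submodule ℂ (Fin n → ℂ)) =
      Module.finrank ℂ W + 1 := by
  have h0 : a ≠ 0 := fun h => ha (h ▸ zero_mem W)
  have h := Submodule.finrank_sup_add_finrank_inf_eq W (Submodule.span ℂ {a})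
  rw [finrank_span_singleton h0, (disjoint_iff.mp ((Submodule.disjoint_span_singleton' h0).mpr ha)),
    finrank_bot, add_zero] at h
  exact h

theorem relRk_insert_of_notMem (A : Multiarrangement ι n) {W : Submodule ℂ (Fin n → ℂ)} {i : ι}
    (hi : A i ∉ W) (X : Finset ι) :
    A.relRk W (insert i X) = A.relRk (W ⊔ Submodule.span ℂ {A i}) X + 1 := by
  rw [relRk, relRk, Finset.coe_insert, Set.image_insert_eq, Submodule.span_insert, ← sup_assoc,
    finrank_sup_span_singleton hi]
  have h : Module.finrank ℂ (W ⊔ Submodule.span ℂ {A i} : Submodule ℂ (Fin n → ℂ)) ≤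
      Module.finrank ℂ (W ⊔ Submodule.span ℂ {A i} ⊔ Submodule.span ℂ (A '' (X : Set ι)) :
        Submodule ℂ (Fin n → ℂ)) := Submodule.finrank_mono le_sup_left
  rw [finrank_sup_span_singleton hi] at h
  omega

/-- The rank generating function of the restriction to `s` of the contraction by `W`. -/
noncomputable def rankSum {R : Type*} [CommRing R] (q t : R) (A : Multiarrangement ι n)
    (s : Finset ι) (W : Submodule ℂ (Fin n → ℂ)) : R :=
  ∑ X ∈ s.powerset, q ^ (s.card - X.card) * (1 - q) ^ (X.card - A.relRk W X) *
    (1 + t) ^ A.relRk W X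

variable {R : Type*} [CommRing R] (q t : R)

theorem rankSum_insert (A : Multiarrangement ι n) {s : Finset ι} {i : ι} (his : i ∉ s)
    (W : Submodule ℂ (Fin n → ℂ)) :
    rankSum q t A (insert i s) W = q * rankSum q t A s W +
      ∑ X ∈ s.powerset, q ^ (s.card - X.card) *
        (1 - q) ^ (X.card + 1 - A.relRk W (insert i X)) * (1 + t) ^ A.relRk W (insert i X) := by
  rw [rankSum, Finset.sum_powerset_insert his, rankSum, Finset.mul_sum]
  refine congrArg₂ _ (Finset.sum_congr rfl fun X hX => ?_) (Finset.sum_congr rfl fun X hX => ?_)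
  · have hXs := Finset.card_le_card (Finset.mem_powerset.mp hX)
    rw [Finset.card_insert_of_notMem his, Nat.succ_sub hXs, pow_succ']
    ring
  · rw [Finset.card_insert_of_notMem his,
      Finset.card_insert_of_notMem fun h => his (Finset.mem_powerset.mp hX h),
      Nat.add_sub_add_right]

/-- Leaving out a loop contributes the factor `q`; including it raises the nullity and contributes
`1 - q`. The factors add up to one. -/
theorem rankSum_insert_of_mem (A : Multiarrangement ι n) {s : Finset ι} {i : ι} (his : i ∉ s)
    {W : Submodule ℂ (Fin n → ℂ)} (hi : A i ∈ W) :
    rankSum q t A (insert i s) W = rankSum q t A s W := by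
  have h : ∑ X ∈ s.powerset, q ^ (s.card - X.card) *
        (1 - q) ^ (X.card + 1 - A.relRk W (insert i X)) * (1 + t) ^ A.relRk W (insert i X) =
      (1 - q) * rankSum q t A s W := by
    rw [rankSum, Finset.mul_sum]
    refine Finset.sum_congr rfl fun X _ => ?_
    rw [relRk_insert_of_mem A hi, Nat.succ_sub (relRk_le_card A W X), pow_succ']
    ring
  rw [rankSum_insert q t A his, h]
  ring

/-- Including a non-loop raises cardinality and rank together, so the nullity is that of the
contraction and only a factor `1 + t` appears. -/
theorem rankSum_insert_of_notMem (A : Multiarrangement ι n) {s : Finset ι} {i : ι} (his : i ∉ s)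
    {W : Submodule ℂ (Fin n → ℂ)} (hi : A i ∉ W) :
    rankSum q t A (insert i s) W = q * rankSum q t A s W +
      (1 + t) * rankSum q t A s (W ⊔ Submodule.span ℂ {A i}) := by
  rw [rankSum_insert q t A his, add_right_inj, rankSum, Finset.mul_sum]
  refine Finset.sum_congr rfl fun X _ => ?_
  rw [relRk_insert_of_notMem A hi, Nat.add_sub_add_right, pow_succ']
  ring

/-- Only the indices must be distinct; repeated normal vectors are allowed. -/
theorem toSeries_recursiveDim (A : Multiarrangement ι n) {l : List ι} (hl : l.Nodup)
    (W : Submodule ℂ (Fin n → ℂ)) :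
    Superspace.toSeries (Superspace.recursiveDim (l.map A) W) =
      rankSum (MvPowerSeries.X 0) (MvPowerSeries.X 1) A l.toFinset W := by
  induction l generalizing W with
  | nil =>
    have h : A.relRk W ∅ = 0 := Nat.le_zero.mp (relRk_le_card A W ∅)
    simp [Superspace.recursiveDim, Superspace.toSeries_ite_zero, rankSum, h]
  | cons i l ih =>
    obtain ⟨hil, hl⟩ := List.nodup_cons.mp hl
    have his : i ∉ l.toFinset := fun h => hil (List.mem_toFinset.mp h)
    rw [List.map_cons, Superspace.recursiveDim, List.toFinset_cons]
    split_ifs with hi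
    · rw [ih hl, rankSum_insert_of_mem _ _ A his hi]
    · rw [rankSum_insert_of_notMem _ _ A his hi, Superspace.toSeries_add,
        Superspace.toSeries_add, Superspace.toSeries_shiftX, Superspace.toSeries_shiftTheta,
        ih hl, ih hl]
      ring

/-- The specialization of the Tutte polynomial that computes the Hilbert series. -/
theorem rankSum_eq_tutte {m : ℕ} (A : Multiarrangement (Fin m) n) {K : Type*} [Field K]
    [Algebra ℤ K] {q t : K} (hq : q ≠ 0) (ht : 1 + t ≠ 0) :
    rankSum q t A Finset.univ ⊥ = (1 + t) ^ A.rank * q ^ ((m : ℤ) - (A.rank : ℤ)) *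
      MvPolynomial.aeval ![(1 + q + t) / (1 + t), 1 / q] A.tutte := by
  rw [tutte, map_sum, Finset.mul_sum, rankSum, Finset.powerset_univ, Finset.card_univ,
    Fintype.card_fin]
  refine Finset.sum_congr rfl fun X _ => ?_
  have h1 : A.rk X ≤ X.card := relRk_bot A X ▸ relRk_le_card A ⊥ X
  have h2 : A.rk X ≤ A.rank := Submodule.finrank_mono
    (Submodule.span_mono (Set.image_mono (Finset.coe_subset.mpr (Finset.subset_univ X))))
  have h3 : X.card ≤ m := by simpa using Finset.card_le_univ X
  -- Here `b` is the nullity of `X`, `c` its corank and `d` the size of its complement, so `m - r =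
  -- b + d - c` and the substituted powers cancel term by term.
  obtain ⟨b, hb⟩ := Nat.exists_eq_add_of_le h1
  obtain ⟨c, hc⟩ := Nat.exists_eq_add_of_le h2
  obtain ⟨d, hd⟩ := Nat.exists_eq_add_of_le h3
  have hx : (1 + q + t) / (1 + t) - 1 = q / (1 + t) := by field_simp; ring
  have hy : 1 / q - 1 = (1 - q) / q := by field_simp
  have hz : q ^ ((m : ℤ) - (A.rank : ℤ)) = q ^ b * q ^ d / q ^ c := by
    rw [eq_div_iff (pow_ne_zero _ hq), ← zpow_natCast, ← zpow_natCast, ← zpow_natCast,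
      ← zpow_add₀ hq, ← zpow_add₀ hq]
    congr 1
    omega
  simp only [map_mul, map_pow, map_sub, map_one, MvPolynomial.aeval_X, Matrix.cons_val_zero,
    Matrix.cons_val_one, hx, hy, hz, relRk_bot]
  rw [show m - X.card = d by omega, show X.card - A.rk X = b by omega,
    show A.rank - A.rk X = c by omega, hc, div_pow, div_pow, pow_add]
  field_simp

end Multiarrangement

/-! ### Orthogonal complements under a nondegenerate pairing -/

section Pairing

variable {M : Type*} [AddCommGroup M] [Module ℂ M]

/-- The orthogonal of a subspace under a pairing that is nondegenerate on a finite-dimensional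
space has complementary dimension. -/
theorem finrank_add_finrank_orthogonal {B : M →ₗ[ℂ] M →ₗ[ℂ] ℂ} {E I D : Submodule ℂ M}
    [Module.Finite ℂ E] (hB : ∀ g ∈ E, (∀ f ∈ E, B f g = 0) → g = 0)
    (hD : ∀ g ∈ E, g ∈ D ↔ ∀ f ∈ I ⊓ E, B f g = 0) :
    Module.finrank ℂ (E ⊓ I : Submodule ℂ M) + Module.finrank ℂ (D ⊓ E : Submodule ℂ M) =
      Module.finrank ℂ E := by
  -- Nondegeneracy in one variable makes `φ` injective, hence an isomorphism by dimension; `D` is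
  -- then the preimage of the annihilator of `I` in `E`.
  let φ : E →ₗ[ℂ] Module.Dual ℂ E := B.flip.compl₁₂ E.subtype E.subtype
  have hφ : Function.Injective φ := by
    rw [injective_iff_map_eq_zero]
    intro g hg
    exact Subtype.ext (hB g g.2 fun f hf => congrArg (fun ψ => ψ ⟨f, hf⟩) hg)
  let e : E ≃ₗ[ℂ] Module.Dual ℂ E :=
    LinearEquiv.ofInjectiveOfFinrankEq φ hφ Subspace.dual_finrank_eq.symm
  have hcomap : D.comap E.subtype = (I.comap E.subtype).dualAnnihilator.comap φ := by
    ext g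
    rw [Submodule.mem_comap, Submodule.mem_comap, Submodule.mem_dualAnnihilator,
      Submodule.subtype_apply, hD g g.2]
    exact ⟨fun h f hf => h f ⟨hf, f.2⟩, fun h f hf => h ⟨f, hf.2⟩ hf.1⟩
  have h1 : Module.finrank ℂ (D.comap E.subtype) =
      Module.finrank ℂ (I.comap E.subtype).dualAnnihilator := by
    rw [hcomap]
    exact (e.ofSubmodule' (I.comap E.subtype).dualAnnihilator).finrank_eq
  rw [← Subspace.finrank_add_finrank_dualAnnihilator_eq (I.comap E.subtype), ← h1,
    ← Submodule.map_comap_subtype, inf_comm D, ← Submodule.map_comap_subtype,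
    Submodule.finrank_map_subtype_eq, Submodule.finrank_map_subtype_eq]

end Pairing

namespace Superspace

open MvPolynomial Multiarrangement

variable {n : ℕ}

/-! ### The pairing of superspace with itself -/

/-- The constant term of a superpolynomial. -/
noncomputable def constantTerm : Superspace n →ₗ[ℂ] ℂ :=
  TensorProduct.lift ((LinearMap.mul ℂ ℂ).compl₁₂ (lcoeff ℂ 0)
    (ExteriorAlgebra.algebraMapInv (R := ℂ) (M := Fin n → ℂ)).toLinearMap)

theorem constantTerm_one : constantTerm (1 : Superspace n) = 1 := by
  rw [Algebra.TensorProduct.one_def, constantTerm, TensorProduct.lift.tmul]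
  simp

/-- The pairing `⟨f, g⟩` given by the constant term of `f ⊙ g`. -/
noncomputable def pairing : Superspace n →ₗ[ℂ] Superspace n →ₗ[ℂ] ℂ :=
  (superOp n).compr₂ constantTerm

theorem pairing_apply (f g : Superspace n) : pairing f g = constantTerm (superOp n f g) := rfl

theorem pairing_mul (f f' g : Superspace n) : pairing (f * f') g = pairing f (superOp n f' g) := by
  rw [pairing_apply, superOp_mul, Module.End.mul_apply, pairing_apply]

theorem mul_bosonicForm_mem (l : Fin n → ℂ) {i j : ℕ} {g : Superspace n}
    (hg : g ∈ bidegree n (i, j)) : g * bosonicForm l ∈ bidegree n (i + 1, j) := by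
  have := mul_mem_bidegree hg (bosonicForm_mem l)
  rwa [Prod.mk_add_mk, add_zero] at this

theorem mul_fermionicForm_mem (l : Fin n → ℂ) {i j : ℕ} {g : Superspace n}
    (hg : g ∈ bidegree n (i, j)) : g * fermionicForm l ∈ bidegree n (i, j + 1) := by
  have := mul_mem_bidegree hg (fermionicForm_mem l)
  rwa [Prod.mk_add_mk, add_zero] at this

theorem mul_bosonicForm_pow_mem (l : Fin n → ℂ) (k : ℕ) {i j : ℕ} {g : Superspace n}
    (hg : g ∈ bidegree n (i, j)) : g * bosonicForm l ^ k ∈ bidegree n (i + k, j) := by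
  induction k with
  | zero => rwa [pow_zero, mul_one]
  | succ k ih =>
    rw [pow_succ, ← mul_assoc]
    exact mul_bosonicForm_mem l ih

/-- Right multiplication of the test element by a variable is adjoint to differentiating `g`
(`pairing_mul`). By induction on the degree all first derivatives of `g` vanish, and the Euler
identities give `g = 0`. -/
theorem eq_zero_of_pairing {p : ℕ × ℕ} {g : Superspace n} (hg : g ∈ bidegree n p)
    (h : ∀ f ∈ bidegree n p, pairing f g = 0) : g = 0 := by
  obtain ⟨i, j⟩ := p
  induction i generalizing g with
  | succ i ih =>
    have hk : ∀ k, derivX (Pi.single k 1) g = 0 := fun k => by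
      refine ih (derivX_mem _ hg) fun f hf => ?_
      exact (pairing_mul f (bosonicForm _) g).symm.trans (h _ (mul_bosonicForm_mem _ hf))
    have := sum_mulX_derivX hg
    simp only [hk, map_zero, Finset.sum_const_zero] at this
    exact (smul_eq_zero_iff_right (Nat.cast_ne_zero.mpr (Nat.succ_ne_zero i))).mp this.symm
  | zero =>
    induction j generalizing g with
    | succ j ih =>
      have hk : ∀ k, derivTheta (Pi.single k 1) g = 0 := fun k => by
        refine ih (derivTheta_mem _ hg) fun f hf => ?_
        exact (pairing_mul f (fermionicForm _) g).symm.trans (h _ (mul_fermionicForm_mem _ hf))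
      have := sum_mulTheta_derivTheta hg
      simp only [hk, map_zero, Finset.sum_const_zero] at this
      exact (smul_eq_zero_iff_right (Nat.cast_ne_zero.mpr (Nat.succ_ne_zero j))).mp this.symm
    | zero =>
      obtain ⟨c, rfl⟩ := exists_eq_smul_one hg
      have := h 1 one_mem_bidegree
      rw [map_smul, pairing_apply, superOp_one, Module.End.one_apply, constantTerm_one,
        smul_eq_mul, mul_one] at this
      rw [this, zero_smul]

/-! ### Euler operator on products -/

theorem euler_tmul (f : BosonicRing n) (b : FermionicRing n) :
    euler n (f ⊗ₜ b) = ∑ i, pderiv i f ⊗ₜ (b * theta i) := by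
  rw [euler, LinearMap.sum_apply]
  rfl

theorem pderiv_lineForm (l : Fin n → ℂ) (i : Fin n) : pderiv i (lineForm l) = C (l i) := by
  rw [← lineDeriv_single, lineDeriv_lineForm, single_one_dotProduct]

theorem sum_smul_theta (l : Fin n → ℂ) : ∑ i, l i • theta i = ExteriorAlgebra.ι ℂ l := by
  conv_rhs => rw [pi_eq_sum_univ' l, map_sum]
  simp only [map_smul, theta]

theorem bosonicForm_mul_comm (l : Fin n → ℂ) (g : Superspace n) :
    bosonicForm l * g = g * bosonicForm l := by
  induction g using TensorProduct.induction_on with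
  | zero => rw [mul_zero, zero_mul]
  | add g h hg hh => rw [mul_add, add_mul, hg, hh]
  | tmul f b =>
    rw [bosonicForm_apply, Algebra.TensorProduct.tmul_mul_tmul,
      Algebra.TensorProduct.tmul_mul_tmul, one_mul, mul_one, mul_comm]

theorem euler_mul_bosonicForm (l : Fin n → ℂ) (g : Superspace n) :
    euler n (g * bosonicForm l) = euler n g * bosonicForm l + g * fermionicForm l := by
  induction g using TensorProduct.induction_on with
  | zero => simp
  | add g h hg hh => simp only [add_mul, map_add, hg, hh]; abel
  | tmul f b =>
    rw [bosonicForm_apply, fermionicForm_apply, Algebra.TensorProduct.tmul_mul_tmul, mul_one,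
      Algebra.TensorProduct.tmul_mul_tmul, mul_one, euler_tmul, euler_tmul, Finset.sum_mul,
      ← sum_smul_theta, Finset.mul_sum, TensorProduct.tmul_sum, ← Finset.sum_add_distrib]
    refine Finset.sum_congr rfl fun i _ => ?_
    rw [Derivation.leibniz, pderiv_lineForm, Algebra.TensorProduct.tmul_mul_tmul, mul_one,
      mul_smul_comm, ← TensorProduct.smul_tmul, ← TensorProduct.add_tmul, smul_eq_mul,
      smul_eq_mul, MvPolynomial.smul_eq_C_mul, mul_comm f, mul_comm (lineForm l), add_comm]

/-- The operator `d` inserts `θᵢ` on the right, so the sign comes from moving it past the last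
factor; for a bosonic last factor there is none. -/
theorem euler_mul_fermionicForm (l : Fin n → ℂ) (g : Superspace n) :
    euler n (g * fermionicForm l) = - (euler n g * fermionicForm l) := by
  induction g using TensorProduct.induction_on with
  | zero => simp
  | add g h hg hh => simp only [add_mul, map_add, hg, hh]; abel
  | tmul f b =>
    rw [fermionicForm_apply, Algebra.TensorProduct.tmul_mul_tmul, mul_one, euler_tmul,
      euler_tmul, Finset.sum_mul, ← Finset.sum_neg_distrib]
    refine Finset.sum_congr rfl fun i _ => ?_
    rw [Algebra.TensorProduct.tmul_mul_tmul, mul_one, mul_assoc, theta, ι_mul_ι_comm, mul_neg,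
      TensorProduct.tmul_neg, mul_assoc]

theorem euler_mul_bosonicForm_pow (l : Fin n → ℂ) (k : ℕ) (g : Superspace n) :
    euler n (g * bosonicForm l ^ (k + 1)) =
      euler n g * bosonicForm l ^ (k + 1) +
        ((k + 1 : ℕ) : ℂ) • (g * (bosonicForm l ^ k * fermionicForm l)) := by
  induction k with
  | zero => simp [euler_mul_bosonicForm]
  | succ k ih =>
    have h : g * (bosonicForm l ^ k * fermionicForm l) * bosonicForm l =
        g * (bosonicForm l ^ (k + 1) * fermionicForm l) := by
      rw [mul_assoc, ← bosonicForm_mul_comm, ← mul_assoc (bosonicForm l), ← pow_succ']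
    rw [pow_succ, ← mul_assoc, euler_mul_bosonicForm, ih, add_mul, smul_mul_assoc, add_assoc, h,
      mul_assoc g, mul_assoc (euler n g), Nat.cast_succ (k + 1), add_smul, one_smul]

theorem fermionicForm_mul_self (l : Fin n → ℂ) : fermionicForm l * fermionicForm l = 0 := by
  rw [fermionicForm_apply, Algebra.TensorProduct.tmul_mul_tmul, ExteriorAlgebra.ι_sq_zero,
    TensorProduct.tmul_zero]

theorem exists_ι_mul_eq (l : Fin n → ℂ) (b : FermionicRing n) :
    ∃ b', ExteriorAlgebra.ι ℂ l * b = b' * ExteriorAlgebra.ι ℂ l := by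
  induction b using ExteriorAlgebra.induction with
  | algebraMap c => exact ⟨_, (Algebra.commutes c _).symm⟩
  | ι a => exact ⟨-ExteriorAlgebra.ι ℂ a, by rw [ι_mul_ι_comm, neg_mul]⟩
  | mul b c hb hc =>
    obtain ⟨b', hb⟩ := hb
    obtain ⟨c', hc⟩ := hc
    exact ⟨b' * c', by rw [← mul_assoc, hb, mul_assoc, hc, mul_assoc]⟩
  | add b c hb hc =>
    obtain ⟨b', hb⟩ := hb
    obtain ⟨c', hc⟩ := hc
    exact ⟨b' + c', by rw [mul_add, hb, hc, add_mul]⟩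

theorem exists_fermionicForm_mul_eq (l : Fin n → ℂ) (g : Superspace n) :
    ∃ g', fermionicForm l * g = g' * fermionicForm l := by
  induction g using TensorProduct.induction_on with
  | zero => exact ⟨0, by rw [mul_zero, zero_mul]⟩
  | add g h hg hh =>
    obtain ⟨g', hg⟩ := hg
    obtain ⟨h', hh⟩ := hh
    exact ⟨g' + h', by rw [mul_add, hg, hh, add_mul]⟩
  | tmul f b =>
    obtain ⟨b', hb⟩ := exists_ι_mul_eq l b
    refine ⟨f ⊗ₜ b', ?_⟩
    rw [fermionicForm_apply, Algebra.TensorProduct.tmul_mul_tmul,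
      Algebra.TensorProduct.tmul_mul_tmul, hb, one_mul, mul_one]

theorem bosonicForm_pow_mem (l : Fin n → ℂ) (k : ℕ) : bosonicForm l ^ k ∈ bidegree n (k, 0) := by
  have := mul_bosonicForm_pow_mem l k (i := 0) (j := 0) one_mem_bidegree
  rwa [one_mul, zero_add] at this

theorem bosonicForm_pow (l : Fin n → ℂ) (k : ℕ) :
    bosonicForm l ^ k = (lineForm l ^ k) ⊗ₜ[ℂ] (1 : FermionicRing n) := by
  rw [bosonicForm_apply, Algebra.TensorProduct.tmul_pow, one_pow]

theorem euler_one : euler n 1 = 0 := by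
  rw [Algebra.TensorProduct.one_def, euler_tmul]
  simp

end Superspace

namespace Multiarrangement

open Superspace

variable {ι : Type*} {n : ℕ}

/-! ### Generators of the superpower ideal -/

/-- The superpowers `λ^{ρ+1}` and `λ^ρ dλ`. -/
def superGenerators [Fintype ι] (A : Multiarrangement ι n) : Set (Superspace n) :=
  {f | ∃ l, l ≠ 0 ∧ (f = bosonicForm l ^ (A.rho l + 1) ∨
    f = bosonicForm l ^ A.rho l * fermionicForm l)}

theorem exists_mem_bidegree_of_mem_superGenerators [Fintype ι] (A : Multiarrangement ι n) {f : Superspace n}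
    (hf : f ∈ A.superGenerators) : ∃ p, f ∈ bidegree n p := by
  obtain ⟨l, -, rfl | rfl⟩ := hf
  · exact ⟨_, bosonicForm_pow_mem l _⟩
  · exact ⟨_, mul_fermionicForm_mem l (bosonicForm_pow_mem l _)⟩

/-- The span is a priori a left ideal. Powers of `λ` are central, and `dλ` times any `c` is some
other element times `dλ` (`exists_fermionicForm_mul_eq`), which suffices without tracking signs. -/
theorem isTwoSided_span_superGenerators [Fintype ι] (A : Multiarrangement ι n) :
    (Ideal.span A.superGenerators).IsTwoSided := by
  have hpow : ∀ l : Fin n → ℂ, ∀ k, ∀ c : Superspace n,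
      bosonicForm l ^ k * c = c * bosonicForm l ^ k := fun l k c =>
    ((show Commute (bosonicForm l) c from bosonicForm_mul_comm l c).pow_left k).eq
  refine ⟨fun {f} c hf => ?_⟩
  induction hf using Submodule.closure_induction with
  | zero => rw [zero_mul]; exact zero_mem _
  | add f g _ _ hf hg => rw [add_mul]; exact add_mem hf hg
  | smul_mem h f hf =>
    rw [smul_eq_mul, mul_assoc]
    refine Ideal.mul_mem_left _ _ ?_
    have hmem := Ideal.subset_span hf
    obtain ⟨l, -, rfl | rfl⟩ := hf
    · rw [hpow]
      exact Ideal.mul_mem_left _ _ hmem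
    · obtain ⟨c', hc⟩ := exists_fermionicForm_mul_eq l c
      rw [mul_assoc, hc, ← mul_assoc, hpow, mul_assoc]
      exact Ideal.mul_mem_left _ _ hmem

/-- Differentiating a multiple of `λ^(ρ+1)` produces multiples of both generators; differentiating a
multiple of `λ^ρ dλ` produces nothing new because `(dλ)² = 0`. -/
theorem euler_mem_span_superGenerators [Fintype ι] (A : Multiarrangement ι n) {f : Superspace n}
    (hf : f ∈ Ideal.span A.superGenerators) : euler n f ∈ Ideal.span A.superGenerators := by
  induction hf using Submodule.closure_induction with
  | zero => rw [map_zero]; exact zero_mem _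
  | add f g _ _ hf hg => rw [map_add]; exact add_mem hf hg
  | smul_mem h f hf =>
    rw [smul_eq_mul]
    obtain ⟨l, hl, rfl | rfl⟩ := hf
    · rw [euler_mul_bosonicForm_pow, ← smul_mul_assoc]
      exact add_mem (Ideal.mul_mem_left _ _ (Ideal.subset_span ⟨l, hl, Or.inl rfl⟩))
        (Ideal.mul_mem_left _ _ (Ideal.subset_span ⟨l, hl, Or.inr rfl⟩))
    · have hmem : bosonicForm l ^ A.rho l * fermionicForm l ∈ Ideal.span A.superGenerators :=
        Ideal.subset_span ⟨l, hl, Or.inr rfl⟩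
      rw [← mul_assoc, euler_mul_fermionicForm]
      refine neg_mem ?_
      cases hk : A.rho l with
      | zero =>
        rw [hk, pow_zero, one_mul] at hmem
        rw [pow_zero, mul_one]
        exact Ideal.mul_mem_left _ _ hmem
      | succ k =>
        rw [hk] at hmem
        rw [euler_mul_bosonicForm_pow, add_mul, smul_mul_assoc, mul_assoc h, mul_assoc _ _
          (fermionicForm l), mul_assoc _ _ (fermionicForm l), fermionicForm_mul_self, mul_zero,
          mul_zero, smul_zero, add_zero]
        exact Ideal.mul_mem_left _ _ hmem

/-- The superpower ideal is generated by the superpowers `λ^{ρ+1}` and `λ^ρ dλ`. -/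
theorem superIdeal_eq_span [Fintype ι] (A : Multiarrangement ι n) :
    A.superIdeal = Ideal.span A.superGenerators := by
  obtain ⟨⟨⟨-, hd⟩, hJ⟩, hleast⟩ := isLeast_differentialClosure (A.powerIdeal 1)
  refine le_antisymm (hleast ⟨⟨isTwoSided_span_superGenerators A,
    fun f hf => euler_mem_span_superGenerators A hf⟩, ?_⟩) ?_
  · have h : A.powerIdeal 1 ≤ (Ideal.span A.superGenerators).comap
        (Algebra.TensorProduct.includeLeft :
          BosonicRing n →ₐ[ℂ] BosonicRing n ⊗[ℂ] FermionicRing n) := by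
      refine Ideal.span_le.mpr ?_
      rintro _ ⟨l, hl, rfl⟩
      exact Ideal.subset_span ⟨l, hl, Or.inl (bosonicForm_pow l _).symm⟩
    exact fun g hg => h hg
  · refine Ideal.span_le.mpr ?_
    have hX : ∀ l : Fin n → ℂ, l ≠ 0 → bosonicForm l ^ (A.rho l + 1) ∈ A.superIdeal :=
      fun l hl => by
        rw [bosonicForm_pow]
        exact hJ _ (Ideal.subset_span ⟨l, hl, rfl⟩)
    rintro _ ⟨l, hl, rfl | rfl⟩
    · exact hX l hl
    -- The derivative of `λ^(ρ+1)` is `(ρ + 1) λ^ρ dλ`, and `ρ + 1` is invertible in `ℂ`.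
    · have h := hd _ (hX l hl)
      rw [← one_mul (bosonicForm l ^ (A.rho l + 1)), euler_mul_bosonicForm_pow, euler_one,
        zero_mul, zero_add, one_mul] at h
      exact ((A.superIdeal.restrictScalars ℂ).smul_mem_iff
        (Nat.cast_ne_zero.mpr (Nat.succ_ne_zero _))).mp h

theorem bigradedProj_mem_superIdeal [Fintype ι] (A : Multiarrangement ι n) (p : ℕ × ℕ) {f : Superspace n}
    (hf : f ∈ A.superIdeal) : bigradedProj p f ∈ A.superIdeal := by
  rw [superIdeal_eq_span] at hf ⊢
  induction hf using Submodule.closure_induction with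
  | zero => rw [map_zero]; exact zero_mem _
  | add f g _ _ hf hg => rw [map_add]; exact add_mem hf hg
  | smul_mem h f hf =>
    obtain ⟨q, hq⟩ := A.exists_mem_bidegree_of_mem_superGenerators hf
    induction h using superspace_induction with
    | add h h' hh hh' => rw [add_smul, map_add]; exact add_mem hh hh'
    | mem r h hr =>
      have hmem := mul_mem_bidegree hr hq
      rw [smul_eq_mul]
      by_cases hp : p = r + q
      · rw [hp, bigradedProj_of_mem hmem]
        exact Ideal.mul_mem_left _ _ (Ideal.subset_span hf)
      · rw [bigradedProj_of_mem_ne hp hmem]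
        exact zero_mem _

/-! ### The inverse system -/

open Classical in
theorem listRho_map [DecidableEq ι] (A : Multiarrangement ι n) (l : Fin n → ℂ) {s : List ι} (hs : s.Nodup) :
    listRho l (s.map A) = (s.toFinset.filter fun i => l ⬝ᵥ A i ≠ 0).card := by
  induction s with
  | nil => rfl
  | cons i s ih =>
    obtain ⟨his, hs⟩ := List.nodup_cons.mp hs
    rw [List.map_cons, List.toFinset_cons, Finset.filter_insert]
    by_cases h : l ⬝ᵥ A i = 0
    · rw [listRho_cons_of_eq h, if_neg (not_not.mpr h), ih hs]
    · rw [listRho_cons_of_ne h, if_pos h, ih hs, Finset.card_insert_of_notMem]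
      exact fun hi => his (List.mem_toFinset.mp (Finset.mem_filter.mp hi).1)

theorem rho_eq_listRho {m : ℕ} (A : Multiarrangement (Fin m) n) (l : Fin n → ℂ) :
    A.rho l = listRho l ((List.finRange m).map A) := by
  rw [listRho_map A l (List.nodup_finRange m), List.toFinset_finRange, rho]
  classical
  refine congrArg Finset.card (Finset.filter_congr fun i _ => ?_)
  rw [Submodule.span_singleton_le_iff_mem, hyperplane, LinearMap.mem_ker, dotProduct_comm]
  rfl

/-- A left multiple `h f` acts by `f` first and then `h`, so it is enough to test the generators. At
`W = ⊥` orthogonality is no restriction on `l`. -/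
theorem inverseSystem_superIdeal {m : ℕ} (A : Multiarrangement (Fin m) n) :
    inverseSystem A.superIdeal = powerSolutions ((List.finRange m).map A) ⊥ := by
  ext g
  have h1 : ∀ l k, superOp n (bosonicForm l ^ k) g = (derivX l ^ k) g := fun l k => by
    rw [superOp_pow]; rfl
  have h2 : ∀ l k, superOp n (bosonicForm l ^ k * fermionicForm l) g =
      (derivX l ^ k) (derivTheta l g) := fun l k => by
    rw [superOp_mul, superOp_pow]; rfl
  constructor
  · intro hg l _
    rw [vanishing_bot, Submodule.mem_bot, Submodule.mem_bot, ← rho_eq_listRho, ← h1, ← h2]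
    -- The zero vector spans no line and gives no generator, but its equations are trivial: the
    -- first has a positive exponent, and the second contains `∂_0^θ = 0` even though `ρ(0) = 0`.
    by_cases hl : l = 0
    · rw [hl, map_zero, map_zero, mul_zero, zero_pow (Nat.succ_ne_zero _), map_zero]
      exact ⟨rfl, rfl⟩
    · exact ⟨hg _ (superIdeal_eq_span A ▸ Ideal.subset_span ⟨l, hl, Or.inl rfl⟩),
        hg _ (superIdeal_eq_span A ▸ Ideal.subset_span ⟨l, hl, Or.inr rfl⟩)⟩
  · intro hg f hf
    rw [superIdeal_eq_span] at hf
    induction hf using Submodule.closure_induction with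
    | zero => rw [map_zero, LinearMap.zero_apply]
    | add f f' _ _ hf hf' => rw [map_add, LinearMap.add_apply, hf, hf', add_zero]
    | smul_mem h f hf =>
      rw [smul_eq_mul, superOp_mul, Module.End.mul_apply]
      obtain ⟨l, -, hf⟩ := hf
      have hl := hg l fun w hw => by rw [(Submodule.mem_bot ℂ).mp hw, dotProduct_zero]
      rw [vanishing_bot, Submodule.mem_bot, Submodule.mem_bot, ← rho_eq_listRho, ← h1, ← h2] at hl
      obtain rfl | rfl := hf
      · rw [hl.1, map_zero]
      · rw [hl.2, map_zero]

end Multiarrangement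

/-! ### Homogeneity of the solution space -/

namespace Superspace

variable {n : ℕ}

theorem derivX_pow_eq_zero_of_lt (l : Fin n → ℂ) {i j k : ℕ} (hik : i < k) {g : Superspace n}
    (hg : g ∈ bidegree n (i, j)) : (derivX l ^ k) g = 0 := by
  obtain ⟨k, rfl⟩ := Nat.exists_eq_add_of_le' (Nat.one_le_of_lt hik)
  rw [pow_succ, Module.End.mul_apply]
  induction i generalizing g k with
  | zero => rw [derivX_eq_zero l hg, map_zero]
  | succ i ih =>
    obtain ⟨k, rfl⟩ := Nat.exists_eq_add_of_le' (Nat.one_le_of_lt (Nat.lt_of_succ_lt_succ hik))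
    rw [pow_succ, Module.End.mul_apply]
    exact ih (derivX_mem l hg) k (Nat.lt_of_succ_lt_succ hik)

theorem derivX_pow_mem (l : Fin n → ℂ) {i j : ℕ} (k : ℕ) {g : Superspace n}
    (hg : g ∈ bidegree n (i + k, j)) : (derivX l ^ k) g ∈ bidegree n (i, j) := by
  rw [← bigradedProj_of_mem hg, ← bigradedProj_derivX_pow l k (i, j)]
  exact bigradedProj_mem _ _

theorem derivX_pow_bigradedProj_eq_zero {l : Fin n → ℂ} {k : ℕ} {g : Superspace n}
    (hg : (derivX l ^ k) g = 0) (p : ℕ × ℕ) : (derivX l ^ k) (bigradedProj p g) = 0 := by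
  by_cases h : p.1 < k
  · exact derivX_pow_eq_zero_of_lt l h (bigradedProj_mem p g)
  · have := bigradedProj_derivX_pow l k (p.1 - k, p.2) g
    rwa [hg, map_zero, Nat.sub_add_cancel (not_lt.mp h), eq_comm] at this

theorem bigradedProj_mem_powerSolutions (L : List (Fin n → ℂ)) (p : ℕ × ℕ) {g : Superspace n}
    (hg : g ∈ powerSolutions L ⊥) : bigradedProj p g ∈ powerSolutions L ⊥ := by
  intro l hl
  have := hg l hl
  rw [vanishing_bot, Submodule.mem_bot, Submodule.mem_bot] at this ⊢
  refine ⟨derivX_pow_bigradedProj_eq_zero this.1 p, ?_⟩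
  obtain ⟨i, _ | j⟩ := p
  · rw [derivTheta_eq_zero l (bigradedProj_mem (i, 0) g), map_zero]
  · rw [← bigradedProj_derivTheta l (i, j)]
    exact derivX_pow_bigradedProj_eq_zero this.2 (i, j)

end Superspace

/-! ### Duality between the quotient and the inverse system -/

namespace Multiarrangement

open Superspace

variable {n m : ℕ}

/-- If `g` has large enough degree, a generator `u` sends it to a homogeneous element whose pairing
with any `f` of that degree is the pairing of `f u` with `g`. As `f u` is in the ideal and in the
bidegree of `g`, nondegeneracy gives `u ⊙ g = 0`. If the degree of `g` is too small, `u` kills it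
anyway. -/
theorem mem_inverseSystem_iff_pairing (A : Multiarrangement (Fin m) n) {p : ℕ × ℕ}
    {g : Superspace n} (hg : g ∈ bidegree n p) :
    g ∈ inverseSystem A.superIdeal ↔
      ∀ f ∈ A.superIdeal.restrictScalars ℂ ⊓ bidegree n p, pairing f g = 0 := by
  refine ⟨fun h f hf => by rw [pairing_apply, h f hf.1, map_zero], fun h => ?_⟩
  obtain ⟨i, j⟩ := p
  rw [inverseSystem_superIdeal]
  have hpow : ∀ l k, superOp n (bosonicForm l ^ k) = derivX l ^ k := fun l k => superOp_pow _ k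
  intro l _
  rw [vanishing_bot, Submodule.mem_bot, Submodule.mem_bot, ← rho_eq_listRho]
  by_cases hl : l = 0
  · rw [hl, map_zero, map_zero, LinearMap.zero_apply, map_zero, zero_pow (Nat.succ_ne_zero _),
      LinearMap.zero_apply]
    exact ⟨rfl, rfl⟩
  constructor
  · by_cases hi : i < A.rho l + 1
    · exact derivX_pow_eq_zero_of_lt l hi hg
    · obtain ⟨i, rfl⟩ := Nat.exists_eq_add_of_le' (not_lt.mp hi)
      refine eq_zero_of_pairing (derivX_pow_mem l _ hg) fun f hf => ?_
      rw [← hpow, ← pairing_mul]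
      refine h _ ⟨Ideal.mul_mem_left _ _ ?_, mul_bosonicForm_pow_mem l _ hf⟩
      exact superIdeal_eq_span A ▸ Ideal.subset_span ⟨l, hl, Or.inl rfl⟩
  · obtain _ | j := j
    · rw [derivTheta_eq_zero l hg, map_zero]
    · by_cases hi : i < A.rho l
      · exact derivX_pow_eq_zero_of_lt l hi (derivTheta_mem l hg)
      · obtain ⟨i, rfl⟩ := Nat.exists_eq_add_of_le' (not_lt.mp hi)
        refine eq_zero_of_pairing (derivX_pow_mem l _ (derivTheta_mem l hg)) fun f hf => ?_
        rw [← hpow]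
        change pairing f ((superOp n (bosonicForm l ^ A.rho l) * superOp n (fermionicForm l)) g) = 0
        rw [← superOp_mul, ← pairing_mul]
        refine h _ ⟨Ideal.mul_mem_left _ _ ?_,
          mul_assoc f _ _ ▸ mul_fermionicForm_mem l (mul_bosonicForm_pow_mem l _ hf)⟩
        exact superIdeal_eq_span A ▸ Ideal.subset_span ⟨l, hl, Or.inr rfl⟩

theorem finrank_inversePiece (A : Multiarrangement (Fin m) n) (p : ℕ × ℕ) :
    Module.finrank ℂ (A.inversePiece p) = Module.finrank ℂ
      (inverseSystem A.superIdeal ⊓ bidegree n p : Submodule ℂ (Superspace n)) := by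
  rw [← Submodule.map_comap_subtype, Submodule.finrank_map_subtype_eq]
  rfl

/-- In each bidegree both sides are the codimension of the ideal: one by rank-nullity for the
quotient map, the other by the pairing. -/
theorem finrank_externalPiece (A : Multiarrangement (Fin m) n) (p : ℕ × ℕ) :
    Module.finrank ℂ (A.externalPiece p) = Module.finrank ℂ (A.inversePiece p) := by
  have hker : LinearMap.ker (Ideal.Quotient.mkₐ ℂ A.superIdeal).toLinearMap =
      A.superIdeal.restrictScalars ℂ := by
    ext f
    exact Ideal.Quotient.eq_zero_iff_mem
  have h1 := finrank_map_add_finrank_inf_ker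
    (Ideal.Quotient.mkₐ ℂ A.superIdeal).toLinearMap (bidegree n p)
  have h2 := finrank_add_finrank_orthogonal (B := pairing) (E := bidegree n p)
    (I := A.superIdeal.restrictScalars ℂ) (D := inverseSystem A.superIdeal)
    (fun g hg => eq_zero_of_pairing hg) (fun g hg => A.mem_inverseSystem_iff_pairing hg)
  rw [hker] at h1
  rw [finrank_inversePiece]
  exact Nat.add_right_cancel (h1.trans ((add_comm _ _).trans h2).symm)

theorem isInternal_externalPiece (A : Multiarrangement (Fin m) n) :
    DirectSum.IsInternal A.externalPiece := by
  refine isInternal_map_of_ker (π := bigradedProj) (fun _ _ => bigradedProj_of_mem)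
    (fun _ _ h _ => bigradedProj_of_mem_ne h) iSup_bidegree
    (Ideal.Quotient.mkₐ ℂ A.superIdeal).toLinearMap Ideal.Quotient.mk_surjective ?_
  intro p f hf
  exact Ideal.Quotient.eq_zero_iff_mem.mpr
    (A.bigradedProj_mem_superIdeal p (Ideal.Quotient.eq_zero_iff_mem.mp hf))

theorem isInternal_inversePiece (A : Multiarrangement (Fin m) n) :
    DirectSum.IsInternal A.inversePiece :=
  isInternal_comap_subtype (π := bigradedProj) (fun _ _ => bigradedProj_of_mem)
    (fun _ _ h _ => bigradedProj_of_mem_ne h) iSup_bidegree fun p g hg => by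
      rw [inverseSystem_superIdeal] at hg ⊢
      exact bigradedProj_mem_powerSolutions _ p hg

theorem bigradedHilbertSeries_inversePiece (A : Multiarrangement (Fin m) n) :
    bigradedHilbertSeries A.inversePiece =
      rankSum (MvPowerSeries.X 0) (MvPowerSeries.X 1) A Finset.univ ⊥ := by
  rw [← List.toFinset_finRange, ← toSeries_recursiveDim A (List.nodup_finRange m)]
  ext a
  rw [coeff_toSeries, ← finrank_powerSolutions, ← inverseSystem_superIdeal,
    ← finrank_inversePiece]
  rfl

end Multiarrangement

/-! ### The identity in the fraction field -/

theorem one_add_tVar_ne_zero : (1 : SeriesField) + tVar ≠ 0 := by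
  have h : (1 : SeriesField) + tVar =
      algebraMap (MvPowerSeries (Fin 2) ℤ) SeriesField (1 + MvPowerSeries.X 1) := by
    rw [map_add, map_one, tVar]
  rw [h, Ne, FaithfulSMul.algebraMap_eq_zero_iff]
  intro h0
  have := congrArg MvPowerSeries.constantCoeff h0
  simp at this

theorem qVar_ne_zero : qVar ≠ 0 := by
  rw [qVar, Ne, FaithfulSMul.algebraMap_eq_zero_iff]
  intro h0
  have := congrArg (MvPowerSeries.coeff (Finsupp.single 0 1)) h0
  simp at this

theorem theorem4p2 (n m r : ℕ) (A : Multiarrangement (Fin m) n) (hr : A.rank = r) :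
    -- `E_A` and `I_A^⊥` are bigraded by bosonic and fermionic degree
    DirectSum.IsInternal A.externalPiece ∧
    DirectSum.IsInternal A.inversePiece ∧
    -- their bigraded Hilbert series coincide
    bigradedHilbertSeries A.externalPiece = bigradedHilbertSeries A.inversePiece ∧
    -- and are the stated specialization of the Tutte polynomial
    algebraMap (MvPowerSeries (Fin 2) ℤ) SeriesField (bigradedHilbertSeries A.externalPiece) =
      (1 + tVar) ^ r * qVar ^ ((m : ℤ) - (r : ℤ)) *
        MvPolynomial.aeval ![(1 + qVar + tVar) / (1 + tVar), 1 / qVar] A.tutte := by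
  have h : bigradedHilbertSeries A.externalPiece = bigradedHilbertSeries A.inversePiece := by
    funext a
    exact congrArg Nat.cast (A.finrank_externalPiece (a 0, a 1))
  refine ⟨A.isInternal_externalPiece, A.isInternal_inversePiece, h, ?_⟩
  subst hr
  rw [h, A.bigradedHilbertSeries_inversePiece]
  refine Eq.trans ?_ (A.rankSum_eq_tutte qVar_ne_zero one_add_tVar_ne_zero)
  simp only [Multiarrangement.rankSum, map_sum, map_mul, map_pow, map_sub, map_add, map_one,
    qVar, tVar]
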